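/- Let $(M,g)$ be a smooth Riemannian manifold of dimension $m$, let $i:M\to S^n$ be an isometric minimal immersion into the unit sphere $S^n\subset\mathbf R^{n+1}$, and let $I:M\to\mathbf R^{n+1}$ be the composition of $i$ with the standard embedding. Then $I$ is an isometric immersion with parallel mean curvature (the mean curvature vector $\mathbf n=\sum_j K_{e_j}e_j$, where $K$ is the second fundamental form of $I$ and $(e_j)$ is an orthonormal frame, is parallel in the normal bundle). Moreover, the Gauss map $$f:M\to \mathrm{Gr}_{p}(\mathbf R^{n+1}),\qquad f(x)=\big(dI_x(T_xM)\big)^{\perp},\qquad p=n+1-m,$$ is an Einstein--Hermitian (EH) harmonic map if and only if $(M,g)$ is an Einstein manifold, that is, $\mathrm{Ric}=c\,g$ for some constant $c\in\mathbf R$. Here $S$ and $Q\cong S^\perp$ denote the tautological and the universal quotient bundle over the Grassmannian, considered as subbundles of the trivial bundle with fibre $\mathbf R^{n+1}$, with orthogonal projections $\pi_S,\pi_Q$ and canonical connections $\nabla^S=\pi_S d$, $\nabla^Q=\pi_Q d$; the Grassmannian has its standard metric, with $T\mathrm{Gr}_p\cong \mathrm{Hom}(S,Q)$ and the Levi-Civita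 connection induced by $\nabla^S$ and $\nabla^Q$. A smooth map $f$ is harmonic if its tension field $\sum_j(\nabla_{e_j}df)(e_j)$ vanishes. With the second fundamental forms $H_Xs=\pi_Q(D_Xs)$ for sections $s$ of $f^{-1}S$ and $K_Xt=\pi_S(D_Xt)$ for sections $t$ of $V=f^{-1}Q$, the mean curvature operator of $f$ is $A=\sum_j H_{e_j}K_{e_j}\in\Gamma(\mathrm{End}\,V)$, and $f$ is Einstein--Hermitian if $A=-\mu\,\mathrm{id}_V$ for some constant $\mu\ge 0$. (Taking oriented planes instead changes nothing, since the oriented Grassmannian is a Riemannian double cover.) -/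

import Mathlib

open scoped Manifold ContDiff

noncomputable section

namespace EHGauss

/-! ### Riemannian geometry in a coordinate domain

`G : ℝᵐ → (ℝᵐ → (ℝᵐ)*)` is a metric tensor in coordinates: `G y u v = ∑ g_ij(y) u_i v_j`. -/

/-- The model space `ℝᵐ`. -/
abbrev Coord (m : ℕ) : Type := EuclideanSpace ℝ (Fin m)

/-- Metric tensors (more generally, fields of bilinear forms) on `ℝᵐ`. -/
abbrev MetricField (m : ℕ) : Type := Coord m → Coord m →L[ℝ] Coord m →L[ℝ] ℝ

/-- Raising an index: the vector `z` with `G y z = α`. -/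
def sharp {m : ℕ} (G : MetricField m) (y : Coord m) (α : Coord m →L[ℝ] ℝ) : Coord m :=
  (G y).inverse α

/-- The covector `w ↦ ½ (∂_u G(v, w) + ∂_v G(u, w) - ∂_w G(u, v))`
(Christoffel symbols of the first kind). -/
def koszul {m : ℕ} (G : MetricField m) (y u v : Coord m) : Coord m →L[ℝ] ℝ :=
  (1 / 2 : ℝ) • (fderiv ℝ G y u v + fderiv ℝ G y v u - ((fderiv ℝ G y).flip u).flip v)

/-- Christoffel symbols: `∇_u v = Γ(u, v)` for the constant vector fields `u`, `v`, where `∇` is the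
Levi-Civita connection of `G`. -/
def christoffel {m : ℕ} (G : MetricField m) (y u v : Coord m) : Coord m :=
  sharp G y (koszul G y u v)

/-- The Riemann curvature tensor `R(u, v) w = ∇_u ∇_v w - ∇_v ∇_u w` (for constant fields). -/
def curvature {m : ℕ} (G : MetricField m) (y u v w : Coord m) : Coord m :=
  fderiv ℝ (fun y' => christoffel G y' v w) y u - fderiv ℝ (fun y' => christoffel G y' u w) y v
    + christoffel G y u (christoffel G y v w) - christoffel G y v (christoffel G y u w)

/-- The Ricci tensor `Ric(v, w) = tr (u ↦ R(u, v) w)`. -/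
def coordRicci {m : ℕ} (G : MetricField m) (y v w : Coord m) : ℝ :=
  ∑ k : Fin m, curvature G y (EuclideanSpace.single k 1) v w k

/-- The metric trace `∑_{k,l} g^{kl} B(∂_k, ∂_l) = ∑_k B(∂_k, (dx^k)^♯)` of a bilinear map `B`,
which equals `∑_i B(e_i, e_i)` for every `G y`-orthonormal basis `(e_i)`. -/
def metricTrace {m : ℕ} {W : Type*} [AddCommMonoid W] (G : MetricField m) (y : Coord m)
    (B : Coord m → Coord m → W) : W :=
  ∑ k : Fin m, B (EuclideanSpace.single k 1) (sharp G y (EuclideanSpace.proj k))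

/-! ### Riemannian manifolds

The tangent space at `x` is, in Mathlib, the model space, a tangent vector being identified with its
coordinates in the preferred chart at `x`. Tensors at `x` are computed in that chart. -/

section Manifold

variable {m : ℕ} {M : Type*} [TopologicalSpace M] [ChartedSpace (Coord m) M]

/-- The coordinates of the point `x` in the preferred chart at `x`. -/
def base (m : ℕ) {M : Type*} [TopologicalSpace M] [ChartedSpace (Coord m) M] (x : M) : Coord m :=
  extChartAt (𝓡 m) x x

/-- A function on `M` read in the preferred chart at `x`. -/
def inChart (m : ℕ) {M : Type*} [TopologicalSpace M] [ChartedSpace (Coord m) M] {F : Type*}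
    (I : M → F) (x : M) : Coord m → F :=
  fun y => I ((extChartAt (𝓡 m) x).symm y)

/-- Smooth Riemannian metrics on `M`. -/
abbrev RiemMetric (m : ℕ) (M : Type*) [TopologicalSpace M] [ChartedSpace (Coord m) M]
    [IsManifold (𝓡 m) ∞ M] : Type _ :=
  Bundle.ContMDiffRiemannianMetric (𝓡 m) ∞ (Coord m) (fun x : M => TangentSpace (𝓡 m) x)

variable [IsManifold (𝓡 m) ∞ M]

/-- The metric tensor `g` in the coordinates given by the preferred chart at `x`. -/
def metricInChart (g : RiemMetric m M) (x : M) : MetricField m := fun y =>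
  let p : M := (extChartAt (𝓡 m) x).symm y
  let gp : Coord m →L[ℝ] Coord m →L[ℝ] ℝ := g.inner p
  let D : Coord m →L[ℝ] Coord m :=
    mfderiv 𝓘(ℝ, Coord m) (𝓡 m) (extChartAt (𝓡 m) x).symm y
  gp.bilinearComp D D

/-- The Ricci tensor of `(M, g)` at `x`. -/
def Ricci (g : RiemMetric m M) (x : M) (v w : TangentSpace (𝓡 m) x) : ℝ :=
  coordRicci (metricInChart g x) (base m x) v w

/-- `(M, g)` is an Einstein manifold: `Ric = c g` for a constant `c`. -/
def IsEinstein (g : RiemMetric m M) : Prop :=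
  ∃ c : ℝ, ∀ (x : M) (v w : TangentSpace (𝓡 m) x), Ricci g x v w = c * g.inner x v w

/-- Trace over a `g`-orthonormal basis of `T_x M`. -/
def traceAt {W : Type*} [AddCommMonoid W] (g : RiemMetric m M) (x : M)
    (B : Coord m → Coord m → W) : W :=
  metricTrace (metricInChart g x) (base m x) B

/-! ### Isometric immersions into a Euclidean space -/

section Immersion

variable {W : Type*} [NormedAddCommGroup W] [InnerProductSpace ℝ W]

/-- The differential `dI_x : T_x M → W`. -/
def differential (I : M → W) (x : M) : Coord m →L[ℝ] W :=
  mfderiv (𝓡 m) 𝓘(ℝ, W) I x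

/-- `I : (M, g) → W` is a (smooth) isometric immersion. -/
def IsIsometricImmersion (g : RiemMetric m M) (I : M → W) : Prop :=
  ContMDiff (𝓡 m) 𝓘(ℝ, W) ∞ I ∧
    ∀ (x : M) (u v : TangentSpace (𝓡 m) x),
      inner ℝ (differential I x u) (differential I x v) = g.inner x u v

/-- The tangent plane `dI (T_x M)` as a subspace of `W`. -/
def tangentPlane (m : ℕ) {M : Type*} [TopologicalSpace M] [ChartedSpace (Coord m) M]
    [IsManifold (𝓡 m) ∞ M] {W : Type*} [NormedAddCommGroup W] [InnerProductSpace ℝ W]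
    (I : M → W) (x : M) : Submodule ℝ W :=
  (differential (m := m) I x).range

/-- The normal space of the immersion `I` at `x`, which is the kernel of the adjoint
`ev_x : W → T_x M` of `dI_x`. -/
def normalSpace (m : ℕ) {M : Type*} [TopologicalSpace M] [ChartedSpace (Coord m) M]
    [IsManifold (𝓡 m) ∞ M] {W : Type*} [NormedAddCommGroup W] [InnerProductSpace ℝ W]
    (I : M → W) (x : M) : Submodule ℝ W :=
  (tangentPlane m I x)ᗮ

/-- The derivative `D_u (dI(v))` at `x`, where `u`, `v` are coordinate (constant) vector fields in the
preferred chart at `x`. -/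
def hessian (I : M → W) (x : M) (u v : Coord m) : W :=
  fderiv ℝ (fun y => fderiv ℝ (inChart m I x) y v) (base m x) u

variable [FiniteDimensional ℝ W]

/-- The second fundamental form of `I : M → W`: the normal component of `D_u (dI(v))`. -/
def secondFundamentalForm (I : M → W) (x : M) (u v : Coord m) : W :=
  (normalSpace m I x).starProjection (hessian I x u v)

/-- The mean curvature vector `𝐧 = ∑ K_{e_i} e_i` of `I : (M, g) → W`. -/
def meanCurvature (g : RiemMetric m M) (I : M → W) (x : M) : W :=
  traceAt g x (secondFundamentalForm I x)

/-- The mean curvature of `I` is parallel in the normal bundle: it is a smooth normal field and the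
normal component of its derivative is zero. -/
def HasParallelMeanCurvature (g : RiemMetric m M) (I : M → W) : Prop :=
  ContMDiff (𝓡 m) 𝓘(ℝ, W) ∞ (meanCurvature g I) ∧
    ∀ (x : M) (u : Coord m),
      (normalSpace m I x).starProjection (differential (meanCurvature g I) x u) = 0

end Immersion

/-! ### Isometric minimal immersions into the unit sphere -/

section Sphere

variable {n : ℕ}

/-- The unit sphere `Sⁿ ⊂ ℝⁿ⁺¹`. -/
abbrev UnitSphere (n : ℕ) : Type := Metric.sphere (0 : EuclideanSpace ℝ (Fin (n + 1))) 1

/-- The standard embedding `Sⁿ → ℝⁿ⁺¹`. -/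
def sphereIncl (n : ℕ) : UnitSphere n → EuclideanSpace ℝ (Fin (n + 1)) := fun p => p

/-- The round metric of `Sⁿ`, induced by the standard embedding. -/
def roundMetric (p : UnitSphere n) (u v : TangentSpace (𝓡 n) p) : ℝ :=
  inner ℝ (differential (m := n) (sphereIncl n) p u) (differential (m := n) (sphereIncl n) p v)

/-- `i : (M, g) → Sⁿ` is a (smooth) isometric immersion. -/
def IsSphereIsometricImmersion (g : RiemMetric m M) (i : M → UnitSphere n) : Prop :=
  ContMDiff (𝓡 m) (𝓡 n) ∞ i ∧
    ∀ (x : M) (u v : TangentSpace (𝓡 m) x),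
      roundMetric (i x) (mfderiv (𝓡 m) (𝓡 n) i x u) (mfderiv (𝓡 m) (𝓡 n) i x v) = g.inner x u v

/-- The normal space at `x` of `i : M → Sⁿ` in the sphere: the vectors that are tangent to `Sⁿ` at
`i x` and orthogonal to the image of `T_x M`. -/
def sphereNormalSpace (m : ℕ) {M : Type*} [TopologicalSpace M] [ChartedSpace (Coord m) M]
    [IsManifold (𝓡 m) ∞ M] (i : M → UnitSphere n) (x : M) :
    Submodule ℝ (EuclideanSpace ℝ (Fin (n + 1))) :=
  tangentPlane n (sphereIncl n) (i x) ⊓ normalSpace m (sphereIncl n ∘ i) x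

/-- The second fundamental form of `i : M → Sⁿ` in the sphere, with values in
`T_{i x} Sⁿ ⊂ ℝⁿ⁺¹`. As the Levi-Civita connection of `Sⁿ` is the tangential part of the flat one,
it is the component of `D_u (di(v))` in the normal space of `M` in `Sⁿ`. -/
def sphereSecondFundamentalForm (i : M → UnitSphere n) (x : M) (u v : Coord m) :
    EuclideanSpace ℝ (Fin (n + 1)) :=
  (sphereNormalSpace m i x).starProjection (hessian (sphereIncl n ∘ i) x u v)

/-- `i : (M, g) → Sⁿ` is an isometric minimal immersion: its mean curvature in `Sⁿ` is zero. -/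
def IsIsometricMinimalImmersion (g : RiemMetric m M) (i : M → UnitSphere n) : Prop :=
  IsSphereIsometricImmersion g i ∧
    ∀ x : M, traceAt g x (sphereSecondFundamentalForm i x) = 0

end Sphere

/-! ### Maps into Grassmannians -/

section Grassmann

variable {W : Type*} [NormedAddCommGroup W] [InnerProductSpace ℝ W] [FiniteDimensional ℝ W] {p : ℕ}

/-- The Grassmannian of `p`-dimensional subspaces of `W`. The fibre at `U` of the tautological bundle
`S` is `U`, and that of the universal quotient bundle `Q` is identified with `Uᗮ`. Planes carry no
orientation here: the Grassmannian of oriented planes is a Riemannian double cover, `S`, `Q` and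
their connections are pulled back along it, so that harmonicity and the mean curvature operator of a
map do not change when the map is lifted to it. -/
def Gr (p : ℕ) (W : Type*) [NormedAddCommGroup W] [InnerProductSpace ℝ W] : Type _ :=
  {U : Submodule ℝ W // Module.finrank ℝ U = p}

/-- The orthogonal projection `π_S` of `W` onto the fibre of `S` at `U`. -/
def projS (U : Gr p W) : W →L[ℝ] W := U.1.starProjection

/-- The orthogonal projection `π_Q` of `W` onto the fibre of `Q` at `U`. -/
def projQ (U : Gr p W) : W →L[ℝ] W := (U.1)ᗮ.starProjection

/-- A map into the Grassmannian is smooth if it is so after the standard embedding `U ↦ π_S(U)` of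
the Grassmannian into `End W`. -/
def IsSmoothMap (m : ℕ) {M : Type*} [TopologicalSpace M] [ChartedSpace (Coord m) M]
    [IsManifold (𝓡 m) ∞ M] (f : M → Gr p W) : Prop :=
  ContMDiff (𝓡 m) 𝓘(ℝ, W →L[ℝ] W) ∞ (fun x => projS (f x))

/-- The second fundamental form `H = π_Q d i_S` of the subbundle `f⁻¹S` of `M × W`, at the point with
coordinates `y` in the preferred chart at `x`: for `s` in the fibre of `f⁻¹S`,
`H_X s = π_Q (D_X s̃)` with the section `s̃ = π_S s` that extends `s`.
It is extended by zero to the fibre of `f⁻¹Q`, so that `Hom(S, Q) ⊂ End W`. Under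
`T Gr = Hom(S, Q)`, `X ↦ H_X` is the differential of `f`. -/
def formH (f : M → Gr p W) (x : M) (y X : Coord m) : W →L[ℝ] W :=
  projQ (inChart m f x y) ∘L fderiv ℝ (fun y' => projS (inChart m f x y')) y X
    ∘L projS (inChart m f x y)

/-- The second fundamental form `K = π_S d i_Q` of the subbundle `V = f⁻¹Q` of `M × W`: for `t` in
the fibre of `V`, `K_X t = π_S (D_X t̃)` with the section `t̃ = π_Q t` that extends `t`.
It is extended by zero to the fibre of `f⁻¹S`. -/
def formK (f : M → Gr p W) (x : M) (y X : Coord m) : W →L[ℝ] W :=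
  projS (inChart m f x y) ∘L fderiv ℝ (fun y' => projQ (inChart m f x y')) y X
    ∘L projQ (inChart m f x y)

/-- The mean curvature operator `A = ∑ H_{e_i} K_{e_i}` of `f` at `x`, an endomorphism of the fibre
`(f x)ᗮ` of `V = f⁻¹Q` (extended by zero to `f x`). -/
def meanCurvatureOperator (g : RiemMetric m M) (f : M → Gr p W) (x : M) : W →L[ℝ] W :=
  traceAt g x (fun u v => formH f x (base m x) u ∘L formK f x (base m x) v)

/-- The second fundamental form `(∇_u df)(v) = ∇_u (df(v)) - df(∇_u v)` of the map `f` at `x`, where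
`u`, `v` are coordinate fields. Here `df = H`, and the Levi-Civita connection of the Grassmannian is
the connection on `T Gr = Hom(S, Q)` induced by the canonical connections `∇^S = π_S d` and
`∇^Q = π_Q d`, which is `h ↦ π_Q (D h) π_S` on `Hom(S, Q) ⊂ End W`. -/
def nablaDf (g : RiemMetric m M) (f : M → Gr p W) (x : M) (u v : Coord m) : W →L[ℝ] W :=
  projQ (f x) ∘L fderiv ℝ (fun y => formH f x y v) (base m x) u ∘L projS (f x)
    - formH f x (base m x) (christoffel (metricInChart g x) (base m x) u v)

/-- The tension field `τ(f) = ∑ (∇_{e_i} df)(e_i)`. -/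
def tensionField (g : RiemMetric m M) (f : M → Gr p W) (x : M) : W →L[ℝ] W :=
  traceAt g x (nablaDf g f x)

/-- Harmonic maps into the Grassmannian: smooth maps with vanishing tension field. -/
def IsHarmonicMap (g : RiemMetric m M) (f : M → Gr p W) : Prop :=
  IsSmoothMap m f ∧ ∀ x : M, tensionField g f x = 0

/-- `f` is Einstein-Hermitian: `A = -μ id_V` for a non-negative constant `μ`. -/
def IsEinsteinHermitian (g : RiemMetric m M) (f : M → Gr p W) : Prop :=
  IsSmoothMap m f ∧
    ∃ μ : ℝ, 0 ≤ μ ∧ ∀ x : M, ∀ t ∈ (f x).1ᗮ, meanCurvatureOperator g f x t = -μ • t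

/-- Einstein-Hermitian harmonic maps. -/
def IsEHHarmonic (g : RiemMetric m M) (f : M → Gr p W) : Prop :=
  IsHarmonicMap g f ∧ IsEinsteinHermitian g f

/-- The normal spaces of an isometric immersion have dimension `dim W - dim M`. -/
theorem IsIsometricImmersion.finrank_normalSpace {g : RiemMetric m M} {I : M → W}
    (hI : IsIsometricImmersion g I) (x : M) :
    Module.finrank ℝ (normalSpace m I x) = Module.finrank ℝ W - m := by
  have hinj : Function.Injective (differential (m := m) I x : Coord m →ₗ[ℝ] W) := by
    rw [← LinearMap.ker_eq_bot, LinearMap.ker_eq_bot']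
    intro v hv
    by_contra hne
    have h1 := g.pos x v hne
    have h2 := hI.2 x v v
    have hv' : differential (m := m) I x v = 0 := hv
    rw [hv', inner_zero_left] at h2
    exact absurd h2 h1.ne
  have h1 := LinearMap.finrank_range_of_inj hinj
  have h2 := (tangentPlane m I x).finrank_add_finrank_orthogonal
  have h3 : Module.finrank ℝ (tangentPlane m I x) = m := by
    refine Eq.trans h1 ?_
    simp
  unfold normalSpace
  omega

/-- The Gauss map `x ↦ ker ev_x` of an isometric immersion `I : (M, g) → W`; its value at `x` is the
normal space of `I` at `x`, so that the fibre of `f⁻¹Q` is the tangent plane. -/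
def gaussMap {g : RiemMetric m M} {I : M → W} (hI : IsIsometricImmersion g I) :
    M → Gr (Module.finrank ℝ W - m) W :=
  fun x => ⟨normalSpace m I x, hI.finrank_normalSpace x⟩

end Grassmann

end Manifold

end EHGauss

end

/-!
For an isometric immersion `I` with second fundamental form `II` and mean curvature vector `𝐧`, the
Gauss map `f` sends a point to its normal space, so that `V = f⁻¹Q` is the tangent bundle. Its
second fundamental forms are `K_u (dI v) = II(u, v)` and `H_u`, minus the shape operator. Hence
`⟪A (dI v), dI w⟫ = -∑ ⟪II(e_j, v), II(e_j, w)⟫`, and the trace of the Gauss equation reads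
`Ric(v, w) = ⟪𝐧, II(v, w)⟫ + ⟪A (dI v), dI w⟫` (`ricci_eq`).

If `I` comes from a minimal immersion into the unit sphere, then `II` differs from the second
fundamental form in the sphere by `-g(u, v) I`, because `⟪I, D²I(u, v)⟫ = -⟪dI u, dI v⟫`. Therefore
`𝐧 = -m I` (`IsIsometricMinimalImmersion.meanCurvature_eq`), whose derivative is tangential, so that
the mean curvature is parallel. Since `⟪𝐧, II(v, w)⟫ = m g(v, w)`, the Gauss equation becomes
`Ric = m g + A` (`IsIsometricMinimalImmersion.ricci_eq`). Consequently `A = -μ id` if and only if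
`Ric = (m - μ) g`; the sign `μ ≥ 0` is automatic because `A ≤ 0`, except when there are no non-zero
tangent vectors, and then `μ = 0` will do.

The harmonicity of the Gauss map is the theorem of Ruh and Vilms: paired with a normal vector `s`
and a tangent vector `w`, `(∇_u df)(v)` is minus the covariant derivative of `II`, which is totally
symmetric by the Codazzi equation, so that the tension field is minus the normal derivative of `𝐧`
(`IsImmersedPatch.inner_fderiv_patchH`, `IsImmersedPatch.inner_fderiv_metricTrace`).

All of this is computed for a parametrized submanifold `J : U → W`, `U ⊂ ℝᵐ` open
(`IsImmersedPatch`), where the second fundamental form is the normal part of `D²J` and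
`dJ(Γ(u, v))` its tangential part. An immersed manifold is such a patch in each chart. As the mean
curvature vector at a point is defined in the preferred chart at that point, differentiating it
needs its independence of the parametrization (`IsImmersedPatch.metricTrace_comp`).
-/

noncomputable section

namespace EHGauss

section Patch

variable {m : ℕ} {W : Type*} [NormedAddCommGroup W] [InnerProductSpace ℝ W]

/-! ### Preliminaries from calculus -/

theorem minSmoothness_two_le_infty : minSmoothness ℝ 2 ≤ ∞ := by
  rw [minSmoothness_of_isRCLikeNormedField]
  exact WithTop.coe_le_coe.2 (le_top (a := (2 : ℕ∞)))

theorem _root_.HasFDerivAt.clm_apply_const {E F V : Type*} [NormedAddCommGroup E]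
    [NormedSpace ℝ E] [NormedAddCommGroup F] [NormedSpace ℝ F] [NormedAddCommGroup V]
    [NormedSpace ℝ V] {A : E → F →L[ℝ] V} {A' : E →L[ℝ] F →L[ℝ] V} {y : E}
    (h : HasFDerivAt A A' y) (v : F) : HasFDerivAt (fun z => A z v) (A'.flip v) y :=
  (h.clm_apply (hasFDerivAt_const v y)).congr_fderiv (by ext; simp)

/-! ### Metric traces -/

theorem eq_sum_smul_single (z : Coord m) : z = ∑ j, z j • EuclideanSpace.single j (1 : ℝ) := by
  ext j
  simp [Finset.sum_apply, Pi.single_apply]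

/-- Cyclicity of the contraction of a bilinear map with `∑ₖ ∂ₖ ⊗ dxᵏ`: an endomorphism `P` acting on
the vectors `∂ₖ` may be moved to the covectors `dxᵏ`. -/
theorem sum_apply_basis_eq_sum_proj_comp {V : Type*} [NormedAddCommGroup V] [NormedSpace ℝ V]
    (B : Coord m →L[ℝ] Coord m →L[ℝ] V) (σ : (Coord m →L[ℝ] ℝ) →L[ℝ] Coord m)
    (P : Coord m →L[ℝ] Coord m) :
    ∑ k : Fin m, B (P (EuclideanSpace.single k 1)) (σ (EuclideanSpace.proj k)) =
      ∑ k : Fin m, B (EuclideanSpace.single k 1) (σ ((EuclideanSpace.proj k).comp P)) := by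
  have hcov : ∀ j : Fin m, (EuclideanSpace.proj j : Coord m →L[ℝ] ℝ).comp P =
      ∑ k, (P (EuclideanSpace.single k 1)) j • (EuclideanSpace.proj k : Coord m →L[ℝ] ℝ) := by
    intro j
    ext z
    conv_lhs => rw [eq_sum_smul_single z]
    simp [mul_comm]
  calc ∑ k : Fin m, B (P (EuclideanSpace.single k 1)) (σ (EuclideanSpace.proj k))
      = ∑ k : Fin m, ∑ j : Fin m, (P (EuclideanSpace.single k 1)) j •
          B (EuclideanSpace.single j 1) (σ (EuclideanSpace.proj k)) := by
        refine Finset.sum_congr rfl fun k _ => ?_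
        conv_lhs => rw [eq_sum_smul_single (P (EuclideanSpace.single k 1))]
        simp
    _ = _ := by
        rw [Finset.sum_comm]
        refine Finset.sum_congr rfl fun j _ => ?_
        rw [hcov j]
        simp

/-- `J : U → W` is a smooth immersion of an open set of `ℝᵐ`, and `G` is on `U` the metric induced
by `J`. -/
structure IsImmersedPatch (U : Set (Coord m)) (J : Coord m → W) (G : MetricField m) : Prop where
  isOpen : IsOpen U
  contDiffOn : ContDiffOn ℝ ∞ J U
  injective : ∀ y ∈ U, Function.Injective (fderiv ℝ J y)
  metric_eq : ∀ y ∈ U, ∀ u v, G y u v = inner ℝ (fderiv ℝ J y u) (fderiv ℝ J y v)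

/-- The orthogonal projection of `W` onto the tangent plane at `y` of the parametrized submanifold
`J`. -/
def tangentProj [FiniteDimensional ℝ W] (J : Coord m → W) (y : Coord m) : W →L[ℝ] W :=
  (fderiv ℝ J y).range.starProjection

/-- The orthogonal projection of `W` onto the normal space at `y` of the parametrized submanifold
`J`. -/
def normalProj [FiniteDimensional ℝ W] (J : Coord m → W) (y : Coord m) : W →L[ℝ] W :=
  ((fderiv ℝ J y).range)ᗮ.starProjection

namespace IsImmersedPatch

variable {U : Set (Coord m)} {J : Coord m → W} {G : MetricField m} {y : Coord m}

section Metric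

theorem mem_nhds (h : IsImmersedPatch U J G) (hy : y ∈ U) : U ∈ nhds y := h.isOpen.mem_nhds hy

theorem contDiffOn_fderiv (h : IsImmersedPatch U J G) : ContDiffOn ℝ ∞ (fderiv ℝ J) U :=
  h.contDiffOn.fderiv_of_isOpen h.isOpen (by simp)

theorem contDiffOn_fderiv_two (h : IsImmersedPatch U J G) :
    ContDiffOn ℝ ∞ (fderiv ℝ (fderiv ℝ J)) U :=
  h.contDiffOn_fderiv.fderiv_of_isOpen h.isOpen (by simp)

theorem differentiableAt_fderiv (h : IsImmersedPatch U J G) (hy : y ∈ U) :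
    DifferentiableAt ℝ (fderiv ℝ J) y :=
  (h.contDiffOn_fderiv.contDiffAt (h.mem_nhds hy)).differentiableAt (by simp)

theorem differentiableAt_fderiv_two (h : IsImmersedPatch U J G) (hy : y ∈ U) :
    DifferentiableAt ℝ (fderiv ℝ (fderiv ℝ J)) y :=
  (h.contDiffOn_fderiv_two.contDiffAt (h.mem_nhds hy)).differentiableAt (by simp)

theorem fderiv_two_symm (h : IsImmersedPatch U J G) (hy : y ∈ U) (u v : Coord m) :
    fderiv ℝ (fderiv ℝ J) y u v = fderiv ℝ (fderiv ℝ J) y v u :=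
  ((h.contDiffOn.contDiffAt (h.mem_nhds hy)).isSymmSndFDerivAt
    minSmoothness_two_le_infty).eq u v

theorem fderiv_three_swap_left (h : IsImmersedPatch U J G) (hy : y ∈ U) (u v w : Coord m) :
    fderiv ℝ (fderiv ℝ (fderiv ℝ J)) y u v w = fderiv ℝ (fderiv ℝ (fderiv ℝ J)) y v u w := by
  rw [((h.contDiffOn_fderiv.contDiffAt (h.mem_nhds hy)).isSymmSndFDerivAt
    minSmoothness_two_le_infty).eq u v]

theorem hasFDerivAt_fderiv_apply (h : IsImmersedPatch U J G) (hy : y ∈ U) (v : Coord m) :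
    HasFDerivAt (fun z => fderiv ℝ J z v) ((fderiv ℝ (fderiv ℝ J) y).flip v) y :=
  (h.differentiableAt_fderiv hy).hasFDerivAt.clm_apply_const v

theorem hasFDerivAt_fderiv_two_apply (h : IsImmersedPatch U J G) (hy : y ∈ U) (v w : Coord m) :
    HasFDerivAt (fun z => fderiv ℝ (fderiv ℝ J) z v w)
      (((fderiv ℝ (fderiv ℝ (fderiv ℝ J)) y).flip v).flip w) y :=
  ((h.differentiableAt_fderiv_two hy).hasFDerivAt.clm_apply_const v).clm_apply_const w

theorem fderiv_three_swap_right (h : IsImmersedPatch U J G) (hy : y ∈ U) (u v w : Coord m) :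
    fderiv ℝ (fderiv ℝ (fderiv ℝ J)) y u v w = fderiv ℝ (fderiv ℝ (fderiv ℝ J)) y u w v := by
  have h1 := h.hasFDerivAt_fderiv_two_apply hy v w
  have h2 := (h.hasFDerivAt_fderiv_two_apply hy w v).congr_of_eventuallyEq
    (f₁ := fun z => fderiv ℝ (fderiv ℝ J) z v w)
    (by filter_upwards [h.mem_nhds hy] with z hz using h.fderiv_two_symm hz v w)
  simpa using congrArg (fun A => A u) (h1.unique h2)

theorem contDiffOn_fderiv_apply (h : IsImmersedPatch U J G) (v : Coord m) :
    ContDiffOn ℝ ∞ (fun z => fderiv ℝ J z v) U :=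
  h.contDiffOn_fderiv.clm_apply contDiffOn_const

theorem contDiffOn_metric (h : IsImmersedPatch U J G) : ContDiffOn ℝ ∞ G U := by
  rw [contDiffOn_clm_apply]
  intro u
  rw [contDiffOn_clm_apply]
  intro v
  exact ((h.contDiffOn_fderiv_apply u).inner ℝ (h.contDiffOn_fderiv_apply v)).congr
    fun z hz => h.metric_eq z hz u v

theorem isInvertible_metric (h : IsImmersedPatch U J G) (hy : y ∈ U) : (G y).IsInvertible := by
  have hinj : Function.Injective (G y : Coord m →ₗ[ℝ] Coord m →L[ℝ] ℝ) := by
    rw [← LinearMap.ker_eq_bot, LinearMap.ker_eq_bot']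
    intro u hu
    have h1 : inner ℝ (fderiv ℝ J y u) (fderiv ℝ J y u) = (0 : ℝ) := by
      rw [← h.metric_eq y hy]
      exact congrArg (fun A : Coord m →L[ℝ] ℝ => A u) hu
    exact h.injective y hy (by rw [inner_self_eq_zero.1 h1, map_zero])
  have hdim : Module.finrank ℝ (Coord m) = Module.finrank ℝ (Coord m →L[ℝ] ℝ) := by
    rw [(LinearMap.toContinuousLinearMap (𝕜 := ℝ) (E := Coord m) (F' := ℝ)).symm.finrank_eq]
    simp
  exact ⟨(LinearEquiv.ofInjectiveOfFinrankEq _ hinj hdim).toContinuousLinearEquiv, by ext; rfl⟩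

theorem metric_sharp (h : IsImmersedPatch U J G) (hy : y ∈ U) (α : Coord m →L[ℝ] ℝ) :
    G y (sharp G y α) = α :=
  (h.isInvertible_metric hy).self_apply_inverse α

theorem sharp_eq (h : IsImmersedPatch U J G) (hy : y ∈ U) {α : Coord m →L[ℝ] ℝ} {z : Coord m}
    (hz : ∀ v, G y z v = α v) : sharp G y α = z :=
  (h.isInvertible_metric hy).injective (by rw [h.metric_sharp hy]; ext v; exact (hz v).symm)

theorem metric_symm (h : IsImmersedPatch U J G) (hy : y ∈ U) (u v : Coord m) :
    G y u v = G y v u := by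
  rw [h.metric_eq y hy, h.metric_eq y hy, real_inner_comm]

theorem contDiffOn_sharp (h : IsImmersedPatch U J G) {α : Coord m → Coord m →L[ℝ] ℝ}
    (hα : ContDiffOn ℝ ∞ α U) : ContDiffOn ℝ ∞ (fun z => sharp G z (α z)) U := by
  have hinv : ContDiffOn ℝ ∞ (fun z => (G z).inverse) U := fun z hz =>
    (h.isInvertible_metric hz).contDiffAt_map_inverse.comp_contDiffWithinAt z
      (h.contDiffOn_metric z hz)
  exact hinv.clm_apply hα

/-- The trace of the metric is the dimension, as `G(∂ₖ, (dxᵏ)^♯) = dxᵏ(∂ₖ) = 1`. -/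
theorem metricTrace_metric (h : IsImmersedPatch U J G) (hy : y ∈ U) :
    metricTrace G y (fun u v => G y u v) = m := by
  simp only [metricTrace]
  calc _ = ∑ k : Fin m, (1 : ℝ) := by
        refine Finset.sum_congr rfl fun k _ => ?_
        rw [h.metric_symm hy, h.metric_sharp hy]
        simp
    _ = m := by simp

end Metric

/-! ### The Levi-Civita connection of an immersed patch -/

section Connection

theorem fderiv_metric (h : IsImmersedPatch U J G) (hy : y ∈ U) (u v w : Coord m) :
    fderiv ℝ G y u v w =
      inner ℝ (fderiv ℝ J y v) (fderiv ℝ (fderiv ℝ J) y u w) +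
        inner ℝ (fderiv ℝ (fderiv ℝ J) y u v) (fderiv ℝ J y w) := by
  have hG : DifferentiableAt ℝ G y :=
    (h.contDiffOn_metric.contDiffAt (h.mem_nhds hy)).differentiableAt (by simp)
  have h1 : HasFDerivAt (fun z => G z v w) (((fderiv ℝ G y).flip v).flip w) y :=
    (hG.hasFDerivAt.clm_apply_const v).clm_apply_const w
  have h2 := ((h.hasFDerivAt_fderiv_apply hy v).inner ℝ
    (h.hasFDerivAt_fderiv_apply hy w)).congr_of_eventuallyEq (f₁ := fun z => G z v w)
    (by filter_upwards [h.mem_nhds hy] with z hz using h.metric_eq z hz v w)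
  simpa [fderivInnerCLM_apply] using congrArg (fun A => A u) (h1.unique h2)

theorem koszul_apply (h : IsImmersedPatch U J G) (hy : y ∈ U) (u v w : Coord m) :
    koszul G y u v w = inner ℝ (fderiv ℝ (fderiv ℝ J) y u v) (fderiv ℝ J y w) := by
  simp only [koszul, smul_apply, add_apply,
    sub_apply, ContinuousLinearMap.flip_apply, h.fderiv_metric hy,
    smul_eq_mul]
  rw [h.fderiv_two_symm hy v u, h.fderiv_two_symm hy w u, h.fderiv_two_symm hy w v,
    real_inner_comm (fderiv ℝ J y v)]
  ring

/-- The vector `dJ(Γ(u, v))` is the tangential part of the second derivative of `J`. -/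
theorem inner_christoffel (h : IsImmersedPatch U J G) (hy : y ∈ U) (u v w : Coord m) :
    inner ℝ (fderiv ℝ J y (christoffel G y u v)) (fderiv ℝ J y w) =
      inner ℝ (fderiv ℝ (fderiv ℝ J) y u v) (fderiv ℝ J y w) := by
  rw [← h.metric_eq y hy, christoffel, h.metric_sharp hy, h.koszul_apply hy]

theorem christoffel_symm (h : IsImmersedPatch U J G) (hy : y ∈ U) (u v : Coord m) :
    christoffel G y u v = christoffel G y v u := by
  unfold christoffel
  congr 1
  ext w
  rw [h.koszul_apply hy, h.koszul_apply hy, h.fderiv_two_symm hy]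

theorem differentiableAt_christoffel (h : IsImmersedPatch U J G) (hy : y ∈ U) (u v : Coord m) :
    DifferentiableAt ℝ (fun z => christoffel G z u v) y := by
  have hk : ContDiffOn ℝ ∞ (fun z => koszul G z u v) U := by
    rw [contDiffOn_clm_apply]
    intro w
    have h2 : ∀ v w : Coord m, ContDiffOn ℝ ∞ (fun z => fderiv ℝ (fderiv ℝ J) z v w) U :=
      fun v w => (h.contDiffOn_fderiv_two.clm_apply contDiffOn_const).clm_apply contDiffOn_const
    exact ((h2 u v).inner ℝ (h.contDiffOn_fderiv_apply w)).congr fun z hz => h.koszul_apply hz u v w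
  exact ((h.contDiffOn_sharp hk).contDiffAt (h.mem_nhds hy)).differentiableAt (by simp)

/-- The Christoffel symbol `Γ(w, ·)` as a linear map. -/
theorem exists_christoffel_clm (h : IsImmersedPatch U J G) (hy : y ∈ U) (w : Coord m) :
    ∃ P : Coord m →L[ℝ] Coord m, ∀ v, P v = christoffel G y w v := by
  have hadd : ∀ a b, christoffel G y w (a + b) = christoffel G y w a + christoffel G y w b := by
    intro a b
    refine h.sharp_eq hy fun v => ?_
    simp [h.metric_eq y hy, h.inner_christoffel hy, h.koszul_apply hy, inner_add_left]
  have hsmul : ∀ (c : ℝ) a, christoffel G y w (c • a) = c • christoffel G y w a := by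
    intro c a
    refine h.sharp_eq hy fun v => ?_
    simp [h.metric_eq y hy, h.inner_christoffel hy, h.koszul_apply hy, inner_smul_left]
  exact ⟨LinearMap.toContinuousLinearMap
    { toFun := christoffel G y w, map_add' := hadd, map_smul' := hsmul }, fun v => rfl⟩

/-- The derivative of the vector field `(dxᵏ)^♯`, or of `α^♯` for any constant covector `α`:
`D_w α^♯ = -Γ(w, α^♯) - (α ∘ Γ(w, ·))^♯`. -/
theorem fderiv_sharp (h : IsImmersedPatch U J G) (hy : y ∈ U) (α : Coord m →L[ℝ] ℝ)
    (w : Coord m) {P : Coord m →L[ℝ] Coord m} (hP : ∀ v, P v = christoffel G y w v) :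
    fderiv ℝ (fun z => sharp G z α) y w =
      -christoffel G y w (sharp G y α) - sharp G y (α.comp P) := by
  have ha : DifferentiableAt ℝ (fun z => sharp G z α) y :=
    ((h.contDiffOn_sharp (α := fun _ => α) contDiffOn_const).contDiffAt
      (h.mem_nhds hy)).differentiableAt (by simp)
  have hG : DifferentiableAt ℝ G y :=
    (h.contDiffOn_metric.contDiffAt (h.mem_nhds hy)).differentiableAt (by simp)
  apply (h.isInvertible_metric hy).injective
  ext v
  have h1 := (hG.hasFDerivAt.clm_apply ha.hasFDerivAt).congr_of_eventuallyEq
    (f₁ := fun _ => α)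
    (by filter_upwards [h.mem_nhds hy] with z hz using (h.metric_sharp hz α).symm)
  have h2 := congrArg (fun A : Coord m →L[ℝ] Coord m →L[ℝ] ℝ => A w v)
    (h1.unique (hasFDerivAt_const α y))
  simp only [add_apply, ContinuousLinearMap.comp_apply,
    ContinuousLinearMap.flip_apply, zero_apply, h.fderiv_metric hy] at h2
  have h3 : G y (christoffel G y w (sharp G y α)) v =
      inner ℝ (fderiv ℝ (fderiv ℝ J) y w (sharp G y α)) (fderiv ℝ J y v) := by
    rw [h.metric_eq y hy, h.inner_christoffel hy]
  have h4 : inner ℝ (fderiv ℝ J y (sharp G y α)) (fderiv ℝ (fderiv ℝ J) y w v) =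
      α (christoffel G y w v) := by
    rw [real_inner_comm, ← h.inner_christoffel hy, ← h.metric_eq y hy, h.metric_symm hy,
      h.metric_sharp hy]
  rw [map_sub, map_neg, sub_apply, neg_apply, h3,
    h.metric_sharp hy, ContinuousLinearMap.comp_apply, hP, ← h4]
  linarith

end Connection

end IsImmersedPatch

/-! ### Tangential and normal projections -/

section Projections

variable [FiniteDimensional ℝ W]

/-- Rewriting `K` in `K.starProjection` is obstructed by its instance argument. -/
theorem starProjection_congr {K L : Submodule ℝ W} (h : K = L) :
    K.starProjection = L.starProjection := by
  subst h
  rfl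

theorem tangentProj_fderiv (J : Coord m → W) (y w : Coord m) :
    tangentProj J y (fderiv ℝ J y w) = fderiv ℝ J y w :=
  Submodule.starProjection_eq_self_iff.2 ⟨w, rfl⟩

theorem tangentProj_eq_sub (J : Coord m → W) (y : Coord m) :
    tangentProj J y = ContinuousLinearMap.id ℝ W - normalProj J y := by
  rw [normalProj, Submodule.starProjection_orthogonal, tangentProj, sub_sub_cancel]

theorem normalProj_fderiv (J : Coord m → W) (y w : Coord m) :
    normalProj J y (fderiv ℝ J y w) = 0 := by
  have h := congrArg (fun A : W →L[ℝ] W => A (fderiv ℝ J y w)) (tangentProj_eq_sub J y)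
  simp only [tangentProj_fderiv, sub_apply, ContinuousLinearMap.id_apply] at h
  exact sub_eq_self.1 h.symm

theorem inner_normalProj_fderiv (J : Coord m → W) (y w : Coord m) (s : W) :
    inner ℝ (normalProj J y s) (fderiv ℝ J y w) = 0 :=
  Submodule.inner_left_of_mem_orthogonal (K := (fderiv ℝ J y).range) ⟨w, rfl⟩
    (Submodule.starProjection_apply_mem _ s)

theorem exists_tangentProj_eq (J : Coord m → W) (y : Coord m) (s : W) :
    ∃ z, tangentProj J y s = fderiv ℝ J y z := by
  obtain ⟨z, hz⟩ := Submodule.starProjection_apply_mem (fderiv ℝ J y).range s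
  exact ⟨z, hz.symm⟩

theorem inner_tangentProj_fderiv (J : Coord m → W) (y w : Coord m) (s : W) :
    inner ℝ (tangentProj J y s) (fderiv ℝ J y w) = inner ℝ s (fderiv ℝ J y w) := by
  rw [tangentProj_eq_sub, sub_apply, inner_sub_left, inner_normalProj_fderiv,
    sub_zero, ContinuousLinearMap.id_apply]

/-- `H_u = π_Q (D_u π_S) π_S` for the bundle `S` of normal spaces and the bundle `Q` of tangent
planes. -/
def patchH (J : Coord m → W) (y u : Coord m) : W →L[ℝ] W :=
  tangentProj J y ∘L fderiv ℝ (normalProj J) y u ∘L normalProj J y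

theorem fderiv_tangentProj (J : Coord m → W) (y : Coord m) :
    fderiv ℝ (tangentProj J) y = -fderiv ℝ (normalProj J) y := by
  rw [funext (tangentProj_eq_sub J), fderiv_const_sub]

theorem normalProj_idem (J : Coord m → W) (y : Coord m) (s : W) :
    normalProj J y (normalProj J y s) = normalProj J y s :=
  Submodule.starProjection_eq_self_iff.2 (Submodule.starProjection_apply_mem _ s)

end Projections

namespace IsImmersedPatch

variable {U : Set (Coord m)} {J : Coord m → W} {G : MetricField m} {y : Coord m}

variable [FiniteDimensional ℝ W]

/-! ### The Gauss equation -/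

section Projections

theorem tangentProj_apply (h : IsImmersedPatch U J G) (hy : y ∈ U) (s : W) :
    tangentProj J y s = fderiv ℝ J y (sharp G y ((innerSL ℝ s).comp (fderiv ℝ J y))) := by
  obtain ⟨z, hz⟩ := exists_tangentProj_eq J y s
  rw [hz, h.sharp_eq hy (z := z)]
  intro v
  rw [h.metric_eq y hy, ← hz, inner_tangentProj_fderiv]
  rfl

theorem contDiffOn_tangentProj (h : IsImmersedPatch U J G) :
    ContDiffOn ℝ ∞ (tangentProj J) U := by
  rw [contDiffOn_clm_apply]
  intro s
  have h1 := h.contDiffOn_sharp (α := fun z => (innerSL ℝ s).comp (fderiv ℝ J z))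
    (contDiffOn_const.clm_comp h.contDiffOn_fderiv)
  exact (h.contDiffOn_fderiv.clm_apply h1).congr fun z hz => h.tangentProj_apply hz s

theorem contDiffOn_normalProj (h : IsImmersedPatch U J G) :
    ContDiffOn ℝ ∞ (normalProj J) U := by
  refine (contDiffOn_const (c := ContinuousLinearMap.id ℝ W)).sub h.contDiffOn_tangentProj
    |>.congr fun z _ => ?_
  rw [tangentProj_eq_sub, sub_sub_cancel]

theorem differentiableAt_normalProj (h : IsImmersedPatch U J G) (hy : y ∈ U) :
    DifferentiableAt ℝ (normalProj J) y :=
  (h.contDiffOn_normalProj.contDiffAt (h.mem_nhds hy)).differentiableAt (by simp)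

theorem tangentProj_fderiv_two (h : IsImmersedPatch U J G) (hy : y ∈ U) (u v : Coord m) :
    tangentProj J y (fderiv ℝ (fderiv ℝ J) y u v) = fderiv ℝ J y (christoffel G y u v) := by
  rw [h.tangentProj_apply hy]
  congr 1
  refine h.sharp_eq hy fun w => ?_
  rw [h.metric_eq y hy, h.inner_christoffel hy]
  rfl

theorem normalProj_fderiv_two (h : IsImmersedPatch U J G) (hy : y ∈ U) (u v : Coord m) :
    normalProj J y (fderiv ℝ (fderiv ℝ J) y u v) =
      fderiv ℝ (fderiv ℝ J) y u v - fderiv ℝ J y (christoffel G y u v) := by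
  rw [← h.tangentProj_fderiv_two hy, tangentProj_eq_sub]
  simp

/-- The derivative of the identity `⟪dJ Γ(v, w), dJ z⟫ = ⟪D²J(v, w), dJ z⟫`. -/
theorem inner_fderiv_christoffel (h : IsImmersedPatch U J G) (hy : y ∈ U) (u v w z : Coord m) :
    G y (fderiv ℝ (fun y' => christoffel G y' v w) y u) z +
        G y (christoffel G y u (christoffel G y v w)) z =
      inner ℝ (fderiv ℝ (fderiv ℝ (fderiv ℝ J)) y u v w) (fderiv ℝ J y z) +
        inner ℝ (normalProj J y (fderiv ℝ (fderiv ℝ J) y v w))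
          (normalProj J y (fderiv ℝ (fderiv ℝ J) y u z)) := by
  have hΓ := (h.differentiableAt_christoffel hy v w).hasFDerivAt
  have h1 := ((h.differentiableAt_fderiv hy).hasFDerivAt.clm_apply hΓ).inner ℝ
    (h.hasFDerivAt_fderiv_apply hy z)
  have h2 := ((h.hasFDerivAt_fderiv_two_apply hy v w).inner ℝ
    (h.hasFDerivAt_fderiv_apply hy z)).congr_of_eventuallyEq
    (f₁ := fun y' => inner ℝ (fderiv ℝ J y' (christoffel G y' v w)) (fderiv ℝ J y' z))
    (by filter_upwards [h.mem_nhds hy] with y' hy' using h.inner_christoffel hy' v w z)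
  have h3 := congrArg (fun A => A u) (h1.unique h2)
  simp [fderivInnerCLM_apply] at h3
  have h4 : inner ℝ (normalProj J y (fderiv ℝ (fderiv ℝ J) y v w))
      (normalProj J y (fderiv ℝ (fderiv ℝ J) y u z)) =
      inner ℝ (normalProj J y (fderiv ℝ (fderiv ℝ J) y v w)) (fderiv ℝ (fderiv ℝ J) y u z) := by
    conv_lhs => rw [h.normalProj_fderiv_two hy u z]
    rw [inner_sub_right, inner_normalProj_fderiv, sub_zero]
  rw [h4, h.normalProj_fderiv_two hy v w, inner_sub_left, h.metric_eq y hy, h.metric_eq y hy,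
    h.inner_christoffel hy u (christoffel G y v w)]
  rw [inner_add_left] at h3
  linarith

/-- The Gauss equation. -/
theorem metric_curvature (h : IsImmersedPatch U J G) (hy : y ∈ U) (u v w z : Coord m) :
    G y (curvature G y u v w) z =
      inner ℝ (normalProj J y (fderiv ℝ (fderiv ℝ J) y v w))
          (normalProj J y (fderiv ℝ (fderiv ℝ J) y u z)) -
        inner ℝ (normalProj J y (fderiv ℝ (fderiv ℝ J) y u w))
          (normalProj J y (fderiv ℝ (fderiv ℝ J) y v z)) := by
  have h1 := h.inner_fderiv_christoffel hy u v w z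
  have h2 := h.inner_fderiv_christoffel hy v u w z
  rw [h.fderiv_three_swap_left hy v u w] at h2
  simp only [curvature, map_add, map_sub, add_apply, sub_apply]
  linarith

/-- The trace of the Gauss equation. -/
theorem coordRicci_eq (h : IsImmersedPatch U J G) (hy : y ∈ U) (v w : Coord m) :
    coordRicci G y v w =
      inner ℝ (normalProj J y (fderiv ℝ (fderiv ℝ J) y v w))
          (metricTrace G y fun a b => normalProj J y (fderiv ℝ (fderiv ℝ J) y a b)) -
        metricTrace G y (fun a b =>
          inner ℝ (normalProj J y (fderiv ℝ (fderiv ℝ J) y a w))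
            (normalProj J y (fderiv ℝ (fderiv ℝ J) y v b))) := by
  simp only [coordRicci, metricTrace]
  rw [inner_sum, ← Finset.sum_sub_distrib]
  refine Finset.sum_congr rfl fun k _ => ?_
  rw [← h.metric_curvature hy, h.metric_symm hy, h.metric_sharp hy]
  rfl

end Projections

/-! ### The Gauss map of an immersed patch -/

section GaussMap

/-- The derivative of the identity `N (dJ w) = 0`. -/
theorem fderiv_normalProj_apply (h : IsImmersedPatch U J G) (hy : y ∈ U) (u w : Coord m) :
    fderiv ℝ (normalProj J) y u (fderiv ℝ J y w) =
      -normalProj J y (fderiv ℝ (fderiv ℝ J) y u w) := by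
  have h1 := (h.differentiableAt_normalProj hy).hasFDerivAt.clm_apply
    (h.hasFDerivAt_fderiv_apply hy w)
  have h2 := (hasFDerivAt_const (𝕜 := ℝ) (0 : W) y).congr_of_eventuallyEq
    (f₁ := fun z => normalProj J z (fderiv ℝ J z w))
    (by filter_upwards with z using normalProj_fderiv J z w)
  have h3 := congrArg (fun A : Coord m →L[ℝ] W => A u) (h1.unique h2)
  simp at h3
  exact eq_neg_of_add_eq_zero_right h3

theorem inner_fderiv_normalProj (h : IsImmersedPatch U J G) (hy : y ∈ U) (u w : Coord m) (s : W) :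
    inner ℝ (fderiv ℝ (normalProj J) y u s) (fderiv ℝ J y w) =
      -inner ℝ (normalProj J y s) (fderiv ℝ (fderiv ℝ J) y u w) := by
  have h1 := ((h.differentiableAt_normalProj hy).hasFDerivAt.clm_apply_const s).inner ℝ
    (h.hasFDerivAt_fderiv_apply hy w)
  have h2 := (hasFDerivAt_const (𝕜 := ℝ) (0 : ℝ) y).congr_of_eventuallyEq
    (f₁ := fun z => inner ℝ (normalProj J z s) (fderiv ℝ J z w))
    (by filter_upwards with z using inner_normalProj_fderiv J z w s)
  have h3 := congrArg (fun A => A u) (h1.unique h2)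
  simp [fderivInnerCLM_apply] at h3
  linarith

/-- `H_u` is minus the shape operator. -/
theorem inner_patchH (h : IsImmersedPatch U J G) (hy : y ∈ U) (u w : Coord m) (s : W) :
    inner ℝ (patchH J y u s) (fderiv ℝ J y w) =
      -inner ℝ (normalProj J y s) (fderiv ℝ (fderiv ℝ J) y u w) := by
  simp only [patchH, ContinuousLinearMap.comp_apply]
  rw [inner_tangentProj_fderiv, h.inner_fderiv_normalProj hy, normalProj_idem]

/-- The derivative of a normal projection maps normal vectors to tangent vectors. -/
theorem fderiv_normalProj_normal (h : IsImmersedPatch U J G) (hy : y ∈ U) (u : Coord m) (s : W) :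
    fderiv ℝ (normalProj J) y u (normalProj J y s) = patchH J y u s := by
  have hN := (h.differentiableAt_normalProj hy).hasFDerivAt
  have hN := (h.differentiableAt_normalProj hy).hasFDerivAt
  have h3 : ∀ s, normalProj J y (fderiv ℝ (normalProj J) y u s) +
      fderiv ℝ (normalProj J) y u (normalProj J y s) = fderiv ℝ (normalProj J) y u s := by
    intro s
    have h1 := hN.clm_apply (hN.clm_apply_const s)
    have h2 := (hN.clm_apply_const s).congr_of_eventuallyEq
      (f₁ := fun z => normalProj J z (normalProj J z s))
      (by filter_upwards with z using normalProj_idem J z s)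
    simpa using congrArg (fun A => A u) (h1.unique h2)
  have h4 := h3 (normalProj J y s)
  rw [normalProj_idem, add_eq_right] at h4
  simp [patchH, tangentProj_eq_sub, h4]

theorem differentiableAt_patchH (h : IsImmersedPatch U J G) (hy : y ∈ U) (u : Coord m) :
    DifferentiableAt ℝ (fun z => patchH J z u) y := by
  have h1 : ContDiffOn ℝ ∞ (fun z => fderiv ℝ (normalProj J) z u) U :=
    (h.contDiffOn_normalProj.fderiv_of_isOpen h.isOpen (by simp)).clm_apply contDiffOn_const
  exact ((h.contDiffOn_tangentProj.clm_comp (h1.clm_comp h.contDiffOn_normalProj)).contDiffAt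
    (h.mem_nhds hy)).differentiableAt (by simp)

/-- The mean curvature operator of the Gauss map of a patch. -/
theorem inner_metricTrace_patchH (h : IsImmersedPatch U J G) (hy : y ∈ U) (v w : Coord m) :
    inner ℝ ((metricTrace G y fun a b => patchH J y a ∘L
        (normalProj J y ∘L fderiv ℝ (tangentProj J) y b ∘L tangentProj J y)) (fderiv ℝ J y v))
          (fderiv ℝ J y w) =
      -metricTrace G y (fun a b =>
          inner ℝ (normalProj J y (fderiv ℝ (fderiv ℝ J) y a w))
            (normalProj J y (fderiv ℝ (fderiv ℝ J) y v b))) := by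
  simp only [metricTrace, sum_apply, sum_inner, ← Finset.sum_neg_distrib]
  refine Finset.sum_congr rfl fun k _ => ?_
  rw [ContinuousLinearMap.comp_apply, h.inner_patchH hy]
  simp only [ContinuousLinearMap.comp_apply, tangentProj_fderiv]
  rw [fderiv_tangentProj, neg_apply, neg_apply, h.fderiv_normalProj_apply hy, neg_neg,
    normalProj_idem, normalProj_idem, h.fderiv_two_symm hy v]
  congr 1
  rw [real_inner_comm, h.normalProj_fderiv_two hy (EuclideanSpace.single k 1) w, inner_sub_left,
    real_inner_comm _ (fderiv ℝ J y _), inner_normalProj_fderiv, sub_zero]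

/-- The component along `s` and `dJ w` of the second fundamental form `(∇_u df)(v)` of the Gauss map
`f` of a patch: it is minus the covariant derivative of the second fundamental form of the patch,
written out in coordinates, and hence symmetric in `u`, `v`, `w` (the Codazzi equation). -/
theorem inner_fderiv_patchH (h : IsImmersedPatch U J G) (hy : y ∈ U) (u v w : Coord m) (s : W)
    (hs : normalProj J y s = s) :
    inner ℝ (fderiv ℝ (fun z => patchH J z v) y u s - patchH J y (christoffel G y u v) s)
        (fderiv ℝ J y w) =
      inner ℝ s (fderiv ℝ (fderiv ℝ J) y v (christoffel G y w u) +
        fderiv ℝ (fderiv ℝ J) y u (christoffel G y w v) +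
        fderiv ℝ (fderiv ℝ J) y w (christoffel G y u v) -
        fderiv ℝ (fderiv ℝ (fderiv ℝ J)) y w u v) := by
  have h1 := (((h.differentiableAt_patchH hy v).hasFDerivAt.clm_apply_const s).inner ℝ
    (h.hasFDerivAt_fderiv_apply hy w))
  have h2 := (((h.differentiableAt_normalProj hy).hasFDerivAt.clm_apply_const s).inner ℝ
    (h.hasFDerivAt_fderiv_two_apply hy v w)).neg.congr_of_eventuallyEq
    (f₁ := fun z => inner ℝ (patchH J z v s) (fderiv ℝ J z w))
    (by filter_upwards [h.mem_nhds hy] with z hz using h.inner_patchH hz v w s)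
  have h3 := congrArg (fun A => A u) (h1.unique h2)
  simp [fderivInnerCLM_apply, hs] at h3
  -- for tangent vectors, second derivatives may be replaced by Christoffel symbols
  have h4 : ∀ a b c, inner ℝ (patchH J y a s) (fderiv ℝ (fderiv ℝ J) y b c) =
      -inner ℝ s (fderiv ℝ (fderiv ℝ J) y a (christoffel G y b c)) := by
    intro a b c
    conv_rhs => rw [← hs]
    rw [← h.inner_patchH hy]
    obtain ⟨z, hz⟩ := exists_tangentProj_eq J y
      (fderiv ℝ (normalProj J) y a (normalProj J y s))
    have : patchH J y a s = fderiv ℝ J y z := hz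
    rw [this, real_inner_comm, ← h.inner_christoffel hy, real_inner_comm]
  have h5 := h.fderiv_normalProj_normal hy u s
  rw [hs] at h5
  rw [h5, h4, h4, h.fderiv_three_swap_right hy u v w, h.fderiv_three_swap_left hy u w v] at h3
  rw [inner_sub_left, h.inner_patchH hy, hs, inner_sub_right, inner_add_right, inner_add_right,
    h.fderiv_two_symm hy w (christoffel G y u v), h.christoffel_symm hy w u,
    h.christoffel_symm hy w v]
  linarith

/-- The normal derivative of the mean curvature vector is the trace of the covariant derivative of
the second fundamental form, because the metric is parallel. -/
theorem inner_fderiv_metricTrace (h : IsImmersedPatch U J G) (hy : y ∈ U) (w : Coord m) (s : W)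
    (hs : normalProj J y s = s) :
    inner ℝ s (fderiv ℝ (fun z => metricTrace G z
        fun a b => normalProj J z (fderiv ℝ (fderiv ℝ J) z a b)) y w) =
      -metricTrace G y (fun u v =>
        inner ℝ s (fderiv ℝ (fderiv ℝ J) y v (christoffel G y w u) +
          fderiv ℝ (fderiv ℝ J) y u (christoffel G y w v) +
          fderiv ℝ (fderiv ℝ J) y w (christoffel G y u v) -
          fderiv ℝ (fderiv ℝ (fderiv ℝ J)) y w u v)) := by
  have hN := (h.differentiableAt_normalProj hy).hasFDerivAt
  have hD := (h.differentiableAt_fderiv_two hy).hasFDerivAt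
  have hσ : ∀ k : Fin m, HasFDerivAt (fun z => sharp G z (EuclideanSpace.proj k))
      (fderiv ℝ (fun z => sharp G z (EuclideanSpace.proj k)) y) y := fun k =>
    (((h.contDiffOn_sharp (α := fun _ => EuclideanSpace.proj k) contDiffOn_const).contDiffAt
      (h.mem_nhds hy)).differentiableAt (by simp)).hasFDerivAt
  have hsum := HasFDerivAt.fun_sum (u := Finset.univ) fun k _ =>
    hN.clm_apply ((hD.clm_apply_const (EuclideanSpace.single k (1 : ℝ))).clm_apply (hσ k))
  -- `P = Γ(w, ·)`, which occurs in the derivative of `(dxᵏ)^♯` and is moved to `∂ₖ` by `hslide`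
  obtain ⟨P, hP⟩ := h.exists_christoffel_clm hy w
  have hsT : ∀ z, inner ℝ s (fderiv ℝ J y z) = 0 := fun z => by
    rw [← hs, inner_normalProj_fderiv]
  have hsN : ∀ x, inner ℝ s (normalProj J y x) = inner ℝ s x := fun x => by
    conv_rhs => rw [← hs]
    exact (Submodule.inner_starProjection_left_eq_right _ s x).symm
  -- the derivative of the projection, on a second derivative of `J`
  have hDN : ∀ a b, inner ℝ s (fderiv ℝ (normalProj J) y w (fderiv ℝ (fderiv ℝ J) y a b)) =
      -inner ℝ s (fderiv ℝ (fderiv ℝ J) y w (christoffel G y a b)) := by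
    intro a b
    have h1 : fderiv ℝ (fderiv ℝ J) y a b = normalProj J y (fderiv ℝ (fderiv ℝ J) y a b) +
        fderiv ℝ J y (christoffel G y a b) := by rw [h.normalProj_fderiv_two hy, sub_add_cancel]
    obtain ⟨z, hz⟩ := exists_tangentProj_eq J y
      (fderiv ℝ (normalProj J) y w (normalProj J y (fderiv ℝ (fderiv ℝ J) y a b)))
    have h2 : patchH J y w (fderiv ℝ (fderiv ℝ J) y a b) = fderiv ℝ J y z := hz
    conv_lhs => rw [h1]
    rw [map_add, h.fderiv_normalProj_normal hy, h2, h.fderiv_normalProj_apply hy,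
      inner_add_right, hsT, inner_neg_right, hsN, zero_add]
  have hslide := sum_apply_basis_eq_sum_proj_comp (fderiv ℝ (fderiv ℝ J) y) (G y).inverse P
  have hslide' := congrArg (fun x => inner ℝ s x) hslide
  simp only [inner_sum] at hslide'
  simp only [metricTrace]
  rw [hsum.fderiv, sum_apply, inner_sum]
  have hk : ∀ k : Fin m, fderiv ℝ (fun z => sharp G z (EuclideanSpace.proj k)) y w =
      -christoffel G y w (sharp G y (EuclideanSpace.proj k)) -
        sharp G y ((EuclideanSpace.proj k : Coord m →L[ℝ] ℝ).comp P) :=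
    fun k => h.fderiv_sharp hy _ w hP
  rw [← sub_eq_zero] at hslide'
  rw [← sub_eq_zero, ← hslide', ← Finset.sum_neg_distrib, ← Finset.sum_sub_distrib,
    ← Finset.sum_sub_distrib]
  refine Finset.sum_congr rfl fun k _ => ?_
  simp only [add_apply, ContinuousLinearMap.comp_apply, ContinuousLinearMap.flip_apply,
    inner_add_right, inner_sub_right, hsN, hDN, hk, map_sub, map_neg, inner_neg_right]
  rw [hP, h.fderiv_two_symm hy (christoffel G y w _)]
  simp only [sharp]
  ring

/-- A patch whose mean curvature vector is parallel in the normal bundle has a Gauss map with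
vanishing tension field. -/
theorem metricTrace_nablaDf_eq_zero (h : IsImmersedPatch U J G) (hy : y ∈ U)
    (hn : ∀ w, normalProj J y (fderiv ℝ (fun z => metricTrace G z
        fun a b => normalProj J z (fderiv ℝ (fderiv ℝ J) z a b)) y w) = 0) :
    metricTrace G y (fun u v => tangentProj J y ∘L fderiv ℝ (fun z => patchH J z v) y u
      ∘L normalProj J y - patchH J y (christoffel G y u v)) = 0 := by
  ext s
  simp only [metricTrace, sum_apply, zero_apply]
  set s' := normalProj J y s with hs'
  have hidem : normalProj J y s' = s' := normalProj_idem J y s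
  have hterm : ∀ u v : Coord m, (tangentProj J y ∘L fderiv ℝ (fun z => patchH J z v) y u
      ∘L normalProj J y - patchH J y (christoffel G y u v)) s =
      tangentProj J y (fderiv ℝ (fun z => patchH J z v) y u s' -
        patchH J y (christoffel G y u v) s') := by
    intro u v
    have h1 : patchH J y (christoffel G y u v) s' = patchH J y (christoffel G y u v) s := by
      simp only [patchH, ContinuousLinearMap.comp_apply]
      rw [hidem]
    have h2 : tangentProj J y (patchH J y (christoffel G y u v) s) =
        patchH J y (christoffel G y u v) s :=
      Submodule.starProjection_eq_self_iff.2 (Submodule.starProjection_apply_mem _ _)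
    rw [map_sub, h1, h2]
    rfl
  simp only [hterm, ← map_sum]
  obtain ⟨z, hz⟩ := exists_tangentProj_eq J y (∑ k : Fin m,
    (fderiv ℝ (fun z => patchH J z (sharp G y (EuclideanSpace.proj k))) y
      (EuclideanSpace.single k 1) s' -
        patchH J y (christoffel G y (EuclideanSpace.single k 1)
          (sharp G y (EuclideanSpace.proj k))) s'))
  rw [← inner_self_eq_zero (𝕜 := ℝ)]
  nth_rewrite 2 [hz]
  rw [inner_tangentProj_fderiv, sum_inner]
  have h3 := h.inner_fderiv_metricTrace hy z s' hidem
  have h4 : inner ℝ s' (fderiv ℝ (fun z => metricTrace G z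
      fun a b => normalProj J z (fderiv ℝ (fderiv ℝ J) z a b)) y z) = 0 := by
    rw [← hidem]
    refine (Submodule.inner_starProjection_left_eq_right _ _ _).trans ?_
    erw [hn z, inner_zero_right]
  rw [h4, eq_comm, neg_eq_zero] at h3
  rw [← h3]
  exact Finset.sum_congr rfl fun k _ => h.inner_fderiv_patchH hy _ _ z s' hidem

end GaussMap

end IsImmersedPatch

/-! ### Orthonormal frames and changes of coordinates -/

namespace IsImmersedPatch

variable {U : Set (Coord m)} {J : Coord m → W} {G : MetricField m} {y : Coord m}

/-- The metric trace of a bilinear form is its trace over an orthonormal basis; hence it is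
non-negative for a positive semidefinite form. -/
theorem metricTrace_nonneg (h : IsImmersedPatch U J G) (hy : y ∈ U)
    (S : Coord m →L[ℝ] Coord m →L[ℝ] ℝ) (hS : ∀ u, 0 ≤ S u u) :
    0 ≤ metricTrace G y (fun a b => S a b) := by
  let b := stdOrthonormalBasis ℝ (fderiv ℝ J y).range
  choose E hE using fun i => (b i).2
  have hexp : ∀ z, z = ∑ i, G y z (E i) • E i := by
    intro z
    apply h.injective y hy
    have h1 := congrArg (fun t : (fderiv ℝ J y).range => (t : W))
      (b.sum_repr' ⟨fderiv ℝ J y z, ⟨z, rfl⟩⟩)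
    simp only [Submodule.coe_sum, Submodule.coe_smul, Submodule.coe_inner] at h1
    rw [map_sum, ← h1]
    refine Finset.sum_congr rfl fun i _ => ?_
    rw [map_smul, h.metric_eq y hy, real_inner_comm]
    congr 1
    · congr 1
      exact (hE i).symm
    · exact (hE i).symm
  have key : metricTrace G y (fun a b => S a b) = ∑ i, S (E i) (E i) := by
    simp only [metricTrace]
    calc _ = ∑ k : Fin m, ∑ i, (E i) k • S (EuclideanSpace.single k 1) (E i) := by
          refine Finset.sum_congr rfl fun k _ => ?_
          conv_lhs => rw [hexp (sharp G y (EuclideanSpace.proj k)), h.metric_sharp hy]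
          simp
      _ = _ := by
          rw [Finset.sum_comm]
          refine Finset.sum_congr rfl fun i _ => ?_
          conv_rhs => enter [1]; rw [eq_sum_smul_single (E i)]
          simp
  rw [key]
  exact Finset.sum_nonneg fun i _ => hS _

/-- The mean curvature vector does not depend on the parametrization. -/
theorem metricTrace_comp [FiniteDimensional ℝ W] (h : IsImmersedPatch U J G) (hy : y ∈ U)
    {U' : Set (Coord m)}
    {J' : Coord m → W} {G' : MetricField m} (h' : IsImmersedPatch U' J' G') {ψ : Coord m → Coord m}
    (hψ : ContDiffAt ℝ ∞ ψ y) (hy' : ψ y ∈ U') (hJ : J =ᶠ[nhds y] J' ∘ ψ) :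
    metricTrace G y (fun a b => normalProj J y (fderiv ℝ (fderiv ℝ J) y a b)) =
      metricTrace G' (ψ y)
        (fun a b => normalProj J' (ψ y) (fderiv ℝ (fderiv ℝ J') (ψ y) a b)) := by
  set P := fderiv ℝ ψ y with hP
  have hψd : ∀ᶠ z in nhds y, DifferentiableAt ℝ ψ z := by
    filter_upwards [(hψ.of_le (m := 1) (by norm_cast)).eventually (by simp)] with z hz
    exact hz.differentiableAt (by simp)
  have hU' : ∀ᶠ z in nhds y, ψ z ∈ U' := hψ.continuousAt (h'.mem_nhds hy')
  have hL : fderiv ℝ J =ᶠ[nhds y] fun z => (fderiv ℝ J' (ψ z)).comp (fderiv ℝ ψ z) := by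
    filter_upwards [hψd, hU', hJ.eventuallyEq_nhds] with z h1 h2 h3
    rw [h3.fderiv_eq, fderiv_comp z
      ((h'.contDiffOn.contDiffAt (h'.mem_nhds h2)).differentiableAt (by simp)) h1]
  have hLy : fderiv ℝ J y = (fderiv ℝ J' (ψ y)).comp P := hL.eq_of_nhds
  have hPinj : Function.Injective P := by
    intro a b hab
    apply h.injective y hy
    rw [hLy, ContinuousLinearMap.comp_apply, ContinuousLinearMap.comp_apply, hab]
  let e : Coord m ≃L[ℝ] Coord m :=
    (LinearEquiv.ofInjectiveEndo (P : Coord m →ₗ[ℝ] Coord m) hPinj).toContinuousLinearEquiv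
  have he : ∀ z, e z = P z := fun z => rfl
  have hrange : (fderiv ℝ J y).range = (fderiv ℝ J' (ψ y)).range := by
    ext t
    constructor
    · rintro ⟨z, rfl⟩
      exact ⟨P z, by rw [hLy]; rfl⟩
    · rintro ⟨z, rfl⟩
      exact ⟨e.symm z, by rw [hLy]; simp [← he]⟩
  have hN : normalProj J y = normalProj J' (ψ y) :=
    starProjection_congr (congrArg Submodule.orthogonal hrange)
  have hψ2 : DifferentiableAt ℝ (fderiv ℝ ψ) y :=
    (hψ.fderiv_right (m := 1) (by norm_cast)).differentiableAt (by simp)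
  have hD2 : ∀ u v, normalProj J y (fderiv ℝ (fderiv ℝ J) y u v) =
      normalProj J' (ψ y) (fderiv ℝ (fderiv ℝ J') (ψ y) (P u) (P v)) := by
    intro u v
    have h1 := ((h'.differentiableAt_fderiv hy').hasFDerivAt.comp y
      hψd.self_of_nhds.hasFDerivAt).clm_comp hψ2.hasFDerivAt
    have h2 := h1.congr_of_eventuallyEq hL
    rw [h2.fderiv, hN]
    simp [normalProj_fderiv, hP]
  have hsharp : ∀ k : Fin m, P (sharp G y (EuclideanSpace.proj k)) =
      sharp G' (ψ y) ((EuclideanSpace.proj k : Coord m →L[ℝ] ℝ).comp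
        (e.symm : Coord m →L[ℝ] Coord m)) := by
    intro k
    refine (h'.sharp_eq hy' fun v => ?_).symm
    obtain ⟨z, rfl⟩ := e.surjective v
    rw [h'.metric_eq _ hy', he, ← ContinuousLinearMap.comp_apply, ← hLy,
      ← ContinuousLinearMap.comp_apply, ← hLy, ← h.metric_eq y hy, h.metric_sharp hy, ← he]
    simp
  have hslide := sum_apply_basis_eq_sum_proj_comp
    ((ContinuousLinearMap.compL ℝ _ _ _ (normalProj J' (ψ y))).comp
      (fderiv ℝ (fderiv ℝ J') (ψ y)))
    ((G' (ψ y)).inverse.comp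
      ((ContinuousLinearMap.compL ℝ _ _ _).flip (e.symm : Coord m →L[ℝ] Coord m))) P
  simp only [ContinuousLinearMap.comp_apply, ContinuousLinearMap.compL_apply,
    ContinuousLinearMap.flip_apply] at hslide
  simp only [metricTrace, hD2, hsharp]
  refine hslide.trans (Finset.sum_congr rfl fun k _ => ?_)
  have : ((EuclideanSpace.proj k : Coord m →L[ℝ] ℝ).comp P).comp
      (e.symm : Coord m →L[ℝ] Coord m) = EuclideanSpace.proj k := by
    ext z
    simp [← he]
  rw [this]
  rfl

end IsImmersedPatch

end Patch

/-! ### Immersed manifolds in coordinates -/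

section Charts

variable {m : ℕ} {M : Type*} [TopologicalSpace M] [ChartedSpace (Coord m) M]
  {W : Type*} [NormedAddCommGroup W] [InnerProductSpace ℝ W]

theorem base_mem_target (x : M) : base m x ∈ (extChartAt (𝓡 m) x).target :=
  mem_extChartAt_target x

theorem symm_base (x : M) : (extChartAt (𝓡 m) x).symm (base m x) = x :=
  extChartAt_to_inv x

theorem inChart_base {F : Type*} (I : M → F) (x : M) : inChart m I x (base m x) = I x :=
  congrArg I (symm_base x)

theorem differential_eq_fderiv {I : M → W} (hI : ContMDiff (𝓡 m) 𝓘(ℝ, W) ∞ I) (x : M) :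
    differential I x = fderiv ℝ (inChart m I x) (base m x) := by
  have h : MDifferentiableAt (𝓡 m) 𝓘(ℝ, W) I x := (hI x).mdifferentiableAt (by simp)
  refine h.mfderiv.trans ?_
  rw [ModelWithCorners.range_eq_univ, fderivWithin_univ]
  rfl

variable [IsManifold (𝓡 m) ∞ M] {g : RiemMetric m M} {I : M → W}

theorem mdifferentiableAt_symm {x : M} {y : Coord m} (hy : y ∈ (extChartAt (𝓡 m) x).target) :
    MDifferentiableAt 𝓘(ℝ, Coord m) (𝓡 m) (extChartAt (𝓡 m) x).symm y := by
  have h := mdifferentiableWithinAt_extChartAt_symm (I := 𝓡 m) hy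
  rwa [ModelWithCorners.range_eq_univ, mdifferentiableWithinAt_univ] at h

theorem isInvertible_mfderiv_symm {x : M} {y : Coord m}
    (hy : y ∈ (extChartAt (𝓡 m) x).target) :
    (mfderiv 𝓘(ℝ, Coord m) (𝓡 m) (extChartAt (𝓡 m) x).symm y).IsInvertible := by
  have h := isInvertible_mfderivWithin_extChartAt_symm (I := 𝓡 m) hy
  rwa [ModelWithCorners.range_eq_univ, mfderivWithin_univ] at h

theorem fderiv_inChart (hI : ContMDiff (𝓡 m) 𝓘(ℝ, W) ∞ I) {x : M} {y : Coord m}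
    (hy : y ∈ (extChartAt (𝓡 m) x).target) :
    fderiv ℝ (inChart m I x) y = (differential I ((extChartAt (𝓡 m) x).symm y)).comp
      (mfderiv 𝓘(ℝ, Coord m) (𝓡 m) (extChartAt (𝓡 m) x).symm y :
        Coord m →L[ℝ] Coord m) := by
  have h := mfderiv_comp y ((hI ((extChartAt (𝓡 m) x).symm y)).mdifferentiableAt (by simp))
    (mdifferentiableAt_symm hy)
  rw [mfderiv_eq_fderiv] at h
  exact h

theorem range_fderiv_inChart (hI : ContMDiff (𝓡 m) 𝓘(ℝ, W) ∞ I) {x : M} {y : Coord m}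
    (hy : y ∈ (extChartAt (𝓡 m) x).target) :
    (fderiv ℝ (inChart m I x) y).range = tangentPlane m I ((extChartAt (𝓡 m) x).symm y) := by
  rw [fderiv_inChart hI hy]
  ext t
  constructor
  · rintro ⟨z, rfl⟩
    exact ⟨_, rfl⟩
  · rintro ⟨z, rfl⟩
    obtain ⟨z', hz'⟩ := (isInvertible_mfderiv_symm hy).surjective z
    exact ⟨z', congrArg (differential I ((extChartAt (𝓡 m) x).symm y)) hz'⟩

/-- An isometric immersion, read in a chart. -/
theorem IsIsometricImmersion.isImmersedPatch (hI : IsIsometricImmersion g I) (x : M) :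
    IsImmersedPatch (extChartAt (𝓡 m) x).target (inChart m I x) (metricInChart g x) where
  isOpen := isOpen_extChartAt_target x
  contDiffOn := contMDiffOn_iff_contDiffOn.1
    (hI.1.comp_contMDiffOn (contMDiffOn_extChartAt_symm x))
  injective y hy := by
    rw [fderiv_inChart hI.1 hy]
    have h1 : Function.Injective (differential (m := m) I ((extChartAt (𝓡 m) x).symm y)) := by
      refine (injective_iff_map_eq_zero _).2 fun v hv => ?_
      by_contra hne
      have h1 := g.pos ((extChartAt (𝓡 m) x).symm y) v hne
      have h2 := hI.2 ((extChartAt (𝓡 m) x).symm y) v v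
      erw [hv, inner_zero_left] at h2
      exact absurd h2 h1.ne
    exact h1.comp (isInvertible_mfderiv_symm hy).injective
  metric_eq y hy u v := by
    rw [fderiv_inChart hI.1 hy]
    exact (hI.2 _ _ _).symm

theorem metricInChart_base (hI : IsIsometricImmersion g I) (x : M) (u v : Coord m) :
    metricInChart g x (base m x) u v = g.inner x u v := by
  rw [(hI.isImmersedPatch x).metric_eq _ (base_mem_target x), ← differential_eq_fderiv hI.1]
  exact hI.2 x u v

theorem hessian_eq (hI : IsIsometricImmersion g I) (x : M) (u v : Coord m) :
    hessian I x u v = fderiv ℝ (fderiv ℝ (inChart m I x)) (base m x) u v := by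
  rw [hessian, ((hI.isImmersedPatch x).hasFDerivAt_fderiv_apply (base_mem_target x) v).fderiv]
  rfl

variable [FiniteDimensional ℝ W]

theorem starProjection_normalSpace (hI : IsIsometricImmersion g I) {x : M} {y : Coord m}
    (hy : y ∈ (extChartAt (𝓡 m) x).target) :
    (normalSpace m I ((extChartAt (𝓡 m) x).symm y)).starProjection =
      normalProj (inChart m I x) y := by
  exact starProjection_congr (congrArg Submodule.orthogonal (range_fderiv_inChart hI.1 hy).symm)

theorem starProjection_normalSpace_base (hI : IsIsometricImmersion g I) (x : M) :
    (normalSpace m I x).starProjection = normalProj (inChart m I x) (base m x) := by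
  rw [← starProjection_normalSpace hI (base_mem_target x), symm_base]

theorem meanCurvature_eq (hI : IsIsometricImmersion g I) (x : M) :
    meanCurvature g I x = metricTrace (metricInChart g x) (base m x) fun a b =>
      normalProj (inChart m I x) (base m x)
        (fderiv ℝ (fderiv ℝ (inChart m I x)) (base m x) a b) := by
  simp only [meanCurvature, traceAt, metricTrace, secondFundamentalForm, hessian_eq hI,
    starProjection_normalSpace_base hI]

end Charts

section Charts

variable {m : ℕ} {M : Type*} [TopologicalSpace M] [ChartedSpace (Coord m) M]
  [IsManifold (𝓡 m) ∞ M] {W : Type*} [NormedAddCommGroup W] [InnerProductSpace ℝ W]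
  [FiniteDimensional ℝ W] {g : RiemMetric m M} {I : M → W}

/-- The mean curvature vector at a point may be computed in a chart that is centred elsewhere. -/
theorem metricTrace_eq_meanCurvature (hI : IsIsometricImmersion g I) {x : M} {y : Coord m}
    (hy : y ∈ (extChartAt (𝓡 m) x).target) :
    metricTrace (metricInChart g x) y (fun a b => normalProj (inChart m I x) y
        (fderiv ℝ (fderiv ℝ (inChart m I x)) y a b)) =
      meanCurvature g I ((extChartAt (𝓡 m) x).symm y) := by
  obtain ⟨p, hp⟩ : ∃ p, p = (extChartAt (𝓡 m) x).symm y := ⟨_, rfl⟩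
  obtain ⟨ψ, hψ⟩ : ∃ ψ, ψ = extChartAt (𝓡 m) p ∘ (extChartAt (𝓡 m) x).symm := ⟨_, rfl⟩
  have hψy : ψ y = base m p := by rw [hψ, Function.comp_apply, ← hp]; rfl
  have hsrc : y ∈ ((extChartAt (𝓡 m) x).symm ≫ extChartAt (𝓡 m) p).source := by
    rw [PartialEquiv.trans_source]
    refine ⟨hy, ?_⟩
    rw [Set.mem_preimage, ← hp]
    exact mem_extChartAt_source p
  have hsmooth := contDiffWithinAt_ext_coord_change (I := 𝓡 m) (n := ∞) p x hsrc
  rw [ModelWithCorners.range_eq_univ, contDiffWithinAt_univ, ← hψ] at hsmooth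
  have hJ : inChart m I x =ᶠ[nhds y] inChart m I p ∘ ψ := by
    have hnhds : (extChartAt (𝓡 m) x).symm ⁻¹' (extChartAt (𝓡 m) p).source ∈ nhds y := by
      refine (continuousAt_extChartAt_symm'' hy).preimage_mem_nhds ?_
      rw [← hp]
      exact extChartAt_source_mem_nhds p
    filter_upwards [hnhds] with z hz
    rw [hψ]
    exact congrArg I ((extChartAt (𝓡 m) p).left_inv hz).symm
  rw [← hp, meanCurvature_eq hI p, ← hψy]
  exact (hI.isImmersedPatch x).metricTrace_comp hy (hI.isImmersedPatch p) hsmooth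
    (hψy ▸ base_mem_target p) hJ

end Charts

/-! ### Minimal immersions into the sphere -/

section Sphere

variable {m n : ℕ} {M : Type*} [TopologicalSpace M] [ChartedSpace (Coord m) M]
  [IsManifold (𝓡 m) ∞ M] {g : RiemMetric m M} {i : M → UnitSphere n}

theorem contMDiff_sphereIncl (n : ℕ) :
    ContMDiff (𝓡 n) 𝓘(ℝ, EuclideanSpace ℝ (Fin (n + 1))) ∞ (sphereIncl n) :=
  haveI : Fact (Module.finrank ℝ (EuclideanSpace ℝ (Fin (n + 1))) = n + 1) := ⟨by simp⟩
  contMDiff_coe_sphere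

theorem tangentPlane_sphereIncl (p : UnitSphere n) :
    tangentPlane n (sphereIncl n) p = (ℝ ∙ (p : EuclideanSpace ℝ (Fin (n + 1))))ᗮ :=
  haveI : Fact (Module.finrank ℝ (EuclideanSpace ℝ (Fin (n + 1))) = n + 1) := ⟨by simp⟩
  range_mvfderiv_subtypeVal p

theorem IsSphereIsometricImmersion.comp_sphereIncl (hi : IsSphereIsometricImmersion g i) :
    IsIsometricImmersion g (sphereIncl n ∘ i) := by
  refine ⟨(contMDiff_sphereIncl n).comp hi.1, fun x u v => ?_⟩
  have h : differential (m := m) (sphereIncl n ∘ i) x =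
      (differential (m := n) (sphereIncl n) (i x)).comp (mfderiv (𝓡 m) (𝓡 n) i x) :=
    mfderiv_comp x ((contMDiff_sphereIncl n _).mdifferentiableAt (by simp))
      ((hi.1 x).mdifferentiableAt (by simp))
  rw [h]
  exact hi.2 x u v

theorem norm_sphereIncl (p : UnitSphere n) : ‖sphereIncl n p‖ = 1 := by
  simp [sphereIncl]

/-- The position vector of a spherical immersion is a normal vector, as `⟪I, I⟫ = 1`. -/
theorem inner_sphere_fderiv (hI : IsIsometricImmersion g (sphereIncl n ∘ i)) {x : M} {y : Coord m}
    (hy : y ∈ (extChartAt (𝓡 m) x).target) (v : Coord m) :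
    inner ℝ (inChart m (sphereIncl n ∘ i) x y) (fderiv ℝ (inChart m (sphereIncl n ∘ i) x) y v) =
      (0 : ℝ) := by
  have hP := hI.isImmersedPatch x
  have hJ := ((hP.contDiffOn.contDiffAt (hP.mem_nhds hy)).differentiableAt (by simp)).hasFDerivAt
  have h1 := hJ.inner ℝ hJ
  have h2 := (hasFDerivAt_const (𝕜 := ℝ) (1 : ℝ) y).congr_of_eventuallyEq
    (f₁ := fun z => inner ℝ (inChart m (sphereIncl n ∘ i) x z) (inChart m (sphereIncl n ∘ i) x z))
    (by
      filter_upwards with z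
      simp [inChart, norm_sphereIncl])
  have h3 := congrArg (fun A => A v) (h1.unique h2)
  simp [fderivInnerCLM_apply] at h3
  rw [real_inner_comm (inChart m (sphereIncl n ∘ i) x y)] at h3
  linarith

/-- The component of `D²I` along the position vector `I` is `-g`, which is the derivative of
`⟪I, dI v⟫ = 0`. -/
theorem inner_sphere_fderiv_two (hI : IsIsometricImmersion g (sphereIncl n ∘ i)) {x : M}
    {y : Coord m} (hy : y ∈ (extChartAt (𝓡 m) x).target) (u v : Coord m) :
    inner ℝ (inChart m (sphereIncl n ∘ i) x y)
        (fderiv ℝ (fderiv ℝ (inChart m (sphereIncl n ∘ i) x)) y u v) =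
      -metricInChart g x y u v := by
  have hP := hI.isImmersedPatch x
  have hJ := ((hP.contDiffOn.contDiffAt (hP.mem_nhds hy)).differentiableAt (by simp)).hasFDerivAt
  have h1 := hJ.inner ℝ (hP.hasFDerivAt_fderiv_apply hy v)
  have h2 := (hasFDerivAt_const (𝕜 := ℝ) (0 : ℝ) y).congr_of_eventuallyEq
    (f₁ := fun z => inner ℝ (inChart m (sphereIncl n ∘ i) x z)
      (fderiv ℝ (inChart m (sphereIncl n ∘ i) x) z v))
    (by filter_upwards [hP.mem_nhds hy] with z hz using inner_sphere_fderiv hI hz v)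
  have h3 := congrArg (fun A => A u) (h1.unique h2)
  simp [fderivInnerCLM_apply] at h3
  rw [hP.metric_eq y hy]
  linarith

theorem normalProj_sphere (hI : IsIsometricImmersion g (sphereIncl n ∘ i)) {x : M} {y : Coord m}
    (hy : y ∈ (extChartAt (𝓡 m) x).target) :
    normalProj (inChart m (sphereIncl n ∘ i) x) y (inChart m (sphereIncl n ∘ i) x y) =
      inChart m (sphereIncl n ∘ i) x y := by
  refine Submodule.starProjection_eq_self_iff.2 ((Submodule.mem_orthogonal' _ _).2 ?_)
  rintro _ ⟨v, rfl⟩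
  exact inner_sphere_fderiv hI hy v

/-- In Euclidean space, the normal space is the sum of the normal space in the sphere and the line
of the position vector. -/
theorem starProjection_sphereNormalSpace (hI : IsIsometricImmersion g (sphereIncl n ∘ i)) (x : M)
    (s : EuclideanSpace ℝ (Fin (n + 1))) :
    (normalSpace m (sphereIncl n ∘ i) x).starProjection s =
      (sphereNormalSpace m i x).starProjection s +
        inner ℝ (sphereIncl n (i x)) s • sphereIncl n (i x) := by
  set ξ := sphereIncl n (i x) with hξ
  set N := normalSpace m (sphereIncl n ∘ i) x with hN
  have hξN : N.starProjection ξ = ξ := by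
    rw [hN, starProjection_normalSpace_base hI]
    have h := normalProj_sphere hI (base_mem_target (m := m) x)
    rwa [show inChart m (sphereIncl n ∘ i) x (base m x) = ξ from inChart_base _ x] at h
  have hξ1 : inner ℝ ξ ξ = (1 : ℝ) := by
    rw [real_inner_self_eq_norm_sq, hξ, norm_sphereIncl, one_pow]
  have hξs : inner ℝ ξ (N.starProjection s) = inner ℝ ξ s := by
    rw [← Submodule.inner_starProjection_left_eq_right, hξN]
  rw [← sub_eq_iff_eq_add]
  refine (Submodule.eq_starProjection_of_mem_of_inner_eq_zero ?_ ?_).symm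
  · refine Submodule.mem_inf.2 ⟨?_, ?_⟩
    · rw [tangentPlane_sphereIncl, Submodule.mem_orthogonal_singleton_iff_inner_right]
      change inner ℝ ξ _ = 0
      rw [inner_sub_right, inner_smul_right, hξs, hξ1, mul_one, sub_self]
    · exact N.sub_mem (Submodule.starProjection_apply_mem _ _)
        (N.smul_mem _ (Submodule.starProjection_eq_self_iff.1 hξN))
  · intro w hw
    obtain ⟨hw1, hw2⟩ := Submodule.mem_inf.1 hw
    rw [tangentPlane_sphereIncl, Submodule.mem_orthogonal_singleton_iff_inner_right] at hw1
    change inner ℝ ξ w = 0 at hw1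
    have hw3 : inner ℝ (N.starProjection s) w = inner ℝ s w := by
      rw [Submodule.inner_starProjection_left_eq_right, Submodule.starProjection_eq_self_iff.2 hw2]
    rw [inner_sub_left, inner_sub_left, inner_smul_left, hw1, hw3]
    simp

/-- The mean curvature vector of a minimal immersion into the sphere is `-m` times the position
vector. -/
theorem IsIsometricMinimalImmersion.meanCurvature_eq (hi : IsIsometricMinimalImmersion g i)
    (x : M) : meanCurvature g (sphereIncl n ∘ i) x = (-m : ℝ) • sphereIncl n (i x) := by
  have hI := hi.1.comp_sphereIncl
  have hP := hI.isImmersedPatch x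
  have hmin := hi.2 x
  have htr := hP.metricTrace_metric (base_mem_target x)
  simp only [traceAt, metricTrace, sphereSecondFundamentalForm] at hmin htr
  simp only [meanCurvature, traceAt, metricTrace, secondFundamentalForm]
  simp only [starProjection_sphereNormalSpace hI, Finset.sum_add_distrib, hmin, zero_add]
  rw [← Finset.sum_smul, ← htr, ← Finset.sum_neg_distrib]
  congr 1
  refine Finset.sum_congr rfl fun k _ => ?_
  rw [hessian_eq hI, ← inner_sphere_fderiv_two hI (base_mem_target x)]
  rw [inChart_base]
  rfl

theorem IsIsometricMinimalImmersion.hasParallelMeanCurvature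
    (hi : IsIsometricMinimalImmersion g i) : HasParallelMeanCurvature g (sphereIncl n ∘ i) := by
  have hI := hi.1.comp_sphereIncl
  have hn : meanCurvature g (sphereIncl n ∘ i) = (-m : ℝ) • (sphereIncl n ∘ i) :=
    funext hi.meanCurvature_eq
  have hsm : ContMDiff (𝓡 m) 𝓘(ℝ, EuclideanSpace ℝ (Fin (n + 1))) ∞
      (meanCurvature g (sphereIncl n ∘ i)) := by
    rw [hn]
    exact (contDiff_const_smul (-m : ℝ)).contMDiff.comp hI.1
  refine ⟨hsm, fun x u => ?_⟩
  have hP := hI.isImmersedPatch x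
  have hJ := (hP.contDiffOn.contDiffAt (hP.mem_nhds (base_mem_target x))).differentiableAt
    (by simp)
  have hc : inChart m (meanCurvature g (sphereIncl n ∘ i)) x =
      (-m : ℝ) • inChart m (sphereIncl n ∘ i) x := by
    rw [hn]
    rfl
  rw [differential_eq_fderiv hsm, hc, fderiv_const_smul hJ, smul_apply, map_smul,
    starProjection_normalSpace_base hI, normalProj_fderiv, smul_zero]

end Sphere

/-! ### The Gauss map of an isometric immersion -/

section GaussMap

variable {m : ℕ} {M : Type*} [TopologicalSpace M] [ChartedSpace (Coord m) M]
  [IsManifold (𝓡 m) ∞ M] {W : Type*} [NormedAddCommGroup W] [InnerProductSpace ℝ W]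
  [FiniteDimensional ℝ W] {g : RiemMetric m M} {I : M → W}

theorem projS_gaussMap (hI : IsIsometricImmersion g I) {x : M} {y : Coord m}
    (hy : y ∈ (extChartAt (𝓡 m) x).target) :
    projS (inChart m (gaussMap hI) x y) = normalProj (inChart m I x) y :=
  starProjection_normalSpace hI hy

theorem projQ_gaussMap (hI : IsIsometricImmersion g I) {x : M} {y : Coord m}
    (hy : y ∈ (extChartAt (𝓡 m) x).target) :
    projQ (inChart m (gaussMap hI) x y) = tangentProj (inChart m I x) y := by
  refine starProjection_congr ?_
  rw [range_fderiv_inChart hI.1 hy]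
  exact Submodule.orthogonal_orthogonal _

theorem isSmoothMap_gaussMap (hI : IsIsometricImmersion g I) : IsSmoothMap m (gaussMap hI) := by
  intro x
  have hP := hI.isImmersedPatch x
  have h1 : ContMDiffAt 𝓘(ℝ, Coord m) 𝓘(ℝ, W →L[ℝ] W) ∞ (normalProj (inChart m I x))
      (extChartAt (𝓡 m) x x) :=
    (hP.contDiffOn_normalProj.contDiffAt (hP.mem_nhds (base_mem_target x))).contMDiffAt
  refine (h1.comp x contMDiffAt_extChartAt).congr_of_eventuallyEq ?_
  filter_upwards [extChartAt_source_mem_nhds (I := 𝓡 m) x] with p hp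
  rw [Function.comp_apply, ← projS_gaussMap hI ((extChartAt (𝓡 m) x).map_source hp)]
  exact congrArg (fun q => projS (gaussMap hI q)) ((extChartAt (𝓡 m) x).left_inv hp).symm

theorem formH_gaussMap (hI : IsIsometricImmersion g I) {x : M} {y : Coord m}
    (hy : y ∈ (extChartAt (𝓡 m) x).target) (u : Coord m) :
    formH (gaussMap hI) x y u = patchH (inChart m I x) y u := by
  have h : (fun z => projS (inChart m (gaussMap hI) x z)) =ᶠ[nhds y]
      normalProj (inChart m I x) := by
    filter_upwards [(hI.isImmersedPatch x).mem_nhds hy] with z hz using projS_gaussMap hI hz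
  rw [formH, patchH, projS_gaussMap hI hy, projQ_gaussMap hI hy, h.fderiv_eq]

theorem formK_gaussMap (hI : IsIsometricImmersion g I) {x : M} {y : Coord m}
    (hy : y ∈ (extChartAt (𝓡 m) x).target) (u : Coord m) :
    formK (gaussMap hI) x y u = normalProj (inChart m I x) y ∘L
      fderiv ℝ (tangentProj (inChart m I x)) y u ∘L tangentProj (inChart m I x) y := by
  have h : (fun z => projQ (inChart m (gaussMap hI) x z)) =ᶠ[nhds y]
      tangentProj (inChart m I x) := by
    filter_upwards [(hI.isImmersedPatch x).mem_nhds hy] with z hz using projQ_gaussMap hI hz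
  rw [formK, projS_gaussMap hI hy, projQ_gaussMap hI hy, h.fderiv_eq]

/-- One direction of the Ruh–Vilms theorem: if the mean curvature vector is parallel in the normal
bundle, then the Gauss map is harmonic. -/
theorem HasParallelMeanCurvature.isHarmonicMap_gaussMap (hI : IsIsometricImmersion g I)
    (h : HasParallelMeanCurvature g I) : IsHarmonicMap g (gaussMap hI) := by
  refine ⟨isSmoothMap_gaussMap hI, fun x => ?_⟩
  have hP := hI.isImmersedPatch x
  have hb := base_mem_target (m := m) x
  have hn : ∀ w, normalProj (inChart m I x) (base m x)
      (fderiv ℝ (fun z => metricTrace (metricInChart g x) z fun a b =>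
        normalProj (inChart m I x) z (fderiv ℝ (fderiv ℝ (inChart m I x)) z a b))
          (base m x) w) = 0 := by
    intro w
    have hev : (fun z => metricTrace (metricInChart g x) z fun a b =>
        normalProj (inChart m I x) z (fderiv ℝ (fderiv ℝ (inChart m I x)) z a b))
          =ᶠ[nhds (base m x)] inChart m (meanCurvature g I) x := by
      filter_upwards [hP.mem_nhds hb] with z hz using metricTrace_eq_meanCurvature hI hz
    rw [hev.fderiv_eq, ← differential_eq_fderiv h.1, ← starProjection_normalSpace_base hI]
    exact h.2 x w
  have hS : projS (gaussMap hI x) = normalProj (inChart m I x) (base m x) := by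
    rw [← projS_gaussMap hI hb, inChart_base]
  have hQ : projQ (gaussMap hI x) = tangentProj (inChart m I x) (base m x) := by
    rw [← projQ_gaussMap hI hb, inChart_base]
  have hH : ∀ v, (fun z => formH (gaussMap hI) x z v) =ᶠ[nhds (base m x)]
      fun z => patchH (inChart m I x) z v := fun v => by
    filter_upwards [hP.mem_nhds hb] with z hz using formH_gaussMap hI hz v
  rw [← hP.metricTrace_nablaDf_eq_zero hb hn]
  simp only [tensionField, traceAt, metricTrace, nablaDf, hS, hQ, (hH _).fderiv_eq,
    formH_gaussMap hI hb]

theorem mem_orthogonal_gaussMap (hI : IsIsometricImmersion g I) (x : M) {t : W} :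
    t ∈ (gaussMap hI x).1ᗮ ↔ ∃ v, differential (m := m) I x v = t := by
  have h : (gaussMap hI x).1ᗮ = tangentPlane m I x := Submodule.orthogonal_orthogonal _
  rw [h]
  rfl

/-- The mean curvature operator takes values in the tangent plane. -/
theorem meanCurvatureOperator_mem (hI : IsIsometricImmersion g I) (x : M) (t : W) :
    meanCurvatureOperator g (gaussMap hI) x t ∈ (gaussMap hI x).1ᗮ := by
  simp only [meanCurvatureOperator, traceAt, metricTrace, sum_apply]
  refine Submodule.sum_mem _ fun k _ => ?_
  have h := inChart_base (m := m) (gaussMap hI) x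
  simp only [formH, ContinuousLinearMap.comp_apply]
  rw [← h]
  exact Submodule.starProjection_apply_mem _ _

/-- The mean curvature operator of the Gauss map is `-∑ ⟪II(e_j, v), II(e_j, w)⟫`. -/
theorem inner_meanCurvatureOperator (hI : IsIsometricImmersion g I) (x : M) (v w : Coord m) :
    inner ℝ (meanCurvatureOperator g (gaussMap hI) x (differential I x v)) (differential I x w) =
      -metricTrace (metricInChart g x) (base m x) (fun a b =>
          inner ℝ (normalProj (inChart m I x) (base m x)
              (fderiv ℝ (fderiv ℝ (inChart m I x)) (base m x) a w))
            (normalProj (inChart m I x) (base m x)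
              (fderiv ℝ (fderiv ℝ (inChart m I x)) (base m x) v b))) := by
  rw [← (hI.isImmersedPatch x).inner_metricTrace_patchH (base_mem_target x),
    differential_eq_fderiv hI.1]
  simp only [meanCurvatureOperator, traceAt, formH_gaussMap hI (base_mem_target x),
    formK_gaussMap hI (base_mem_target x)]

theorem inner_meanCurvatureOperator_nonpos (hI : IsIsometricImmersion g I) (x : M) (v : Coord m) :
    inner ℝ (meanCurvatureOperator g (gaussMap hI) x (differential I x v))
      (differential I x v) ≤ 0 := by
  have hP := hI.isImmersedPatch x
  rw [inner_meanCurvatureOperator, neg_nonpos]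
  -- the trace is that of the form `(a, b) ↦ ⟪II(v, a), II(v, b)⟫`
  let K : Coord m →L[ℝ] W := (normalProj (inChart m I x) (base m x)).comp
    (fderiv ℝ (fderiv ℝ (inChart m I x)) (base m x) v)
  have h := hP.metricTrace_nonneg (base_mem_target x) ((innerSL ℝ).bilinearComp K K)
    fun u => real_inner_self_nonneg
  convert h using 3 with a b
  rw [hP.fderiv_two_symm (base_mem_target x) a v]
  rfl

/-- The traced Gauss equation: the Ricci tensor is the second fundamental form in the direction of
the mean curvature vector plus the mean curvature operator of the Gauss map. -/
theorem ricci_eq (hI : IsIsometricImmersion g I) (x : M) (v w : Coord m) :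
    Ricci g x v w =
      inner ℝ (fderiv ℝ (fderiv ℝ (inChart m I x)) (base m x) v w) (meanCurvature g I x) +
        inner ℝ (meanCurvatureOperator g (gaussMap hI) x (differential I x v))
          (differential I x w) := by
  have hP := hI.isImmersedPatch x
  change coordRicci (metricInChart g x) (base m x) v w = _
  rw [inner_meanCurvatureOperator, ← sub_eq_add_neg, hP.coordRicci_eq (base_mem_target x),
    ← meanCurvature_eq hI]
  congr 1
  have h : (normalSpace m I x).starProjection (meanCurvature g I x) = meanCurvature g I x := by
    refine Submodule.starProjection_eq_self_iff.2 ?_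
    simp only [meanCurvature, traceAt, metricTrace]
    exact Submodule.sum_mem _ fun k _ => Submodule.starProjection_apply_mem _ _
  rw [← starProjection_normalSpace_base hI, Submodule.inner_starProjection_left_eq_right, h]

end GaussMap

/-! ### The Einstein condition -/

section Sphere

variable {m n : ℕ} {M : Type*} [TopologicalSpace M] [ChartedSpace (Coord m) M]
  [IsManifold (𝓡 m) ∞ M] {g : RiemMetric m M} {i : M → UnitSphere n}

/-- For a minimal immersion into the sphere, `Ric = m g + A`. -/
theorem IsIsometricMinimalImmersion.ricci_eq (hi : IsIsometricMinimalImmersion g i)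
    (hI : IsIsometricImmersion g (sphereIncl n ∘ i)) (x : M) (v w : Coord m) :
    Ricci g x v w = m * g.inner x v w +
      inner ℝ (meanCurvatureOperator g (gaussMap hI) x (differential (sphereIncl n ∘ i) x v))
        (differential (sphereIncl n ∘ i) x w) := by
  rw [EHGauss.ricci_eq hI, hi.meanCurvature_eq, inner_smul_right, real_inner_comm]
  have h := inner_sphere_fderiv_two hI (base_mem_target x) v w
  rw [inChart_base, metricInChart_base hI] at h
  erw [h]
  ring

theorem IsIsometricMinimalImmersion.isEinsteinHermitian_gaussMap_iff
    (hi : IsIsometricMinimalImmersion g i) (hI : IsIsometricImmersion g (sphereIncl n ∘ i)) :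
    IsEinsteinHermitian g (gaussMap hI) ↔ IsEinstein g := by
  constructor
  · rintro ⟨-, μ, -, hμ⟩
    refine ⟨m - μ, fun x v w => ?_⟩
    have hv := hμ x _ ((mem_orthogonal_gaussMap hI x).2 ⟨v, rfl⟩)
    have hvw := hI.2 x v w
    refine (hi.ricci_eq hI x v w).trans ?_
    rw [hv, inner_smul_left, hvw]
    simp
    ring
  · rintro ⟨c, hc⟩
    refine ⟨isSmoothMap_gaussMap hI, ?_⟩
    have hinner : ∀ (x : M) (v w : Coord m), inner ℝ (meanCurvatureOperator g (gaussMap hI) x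
        (differential (sphereIncl n ∘ i) x v)) (differential (sphereIncl n ∘ i) x w) =
        (c - m) * inner ℝ (differential (sphereIncl n ∘ i) x v)
          (differential (sphereIncl n ∘ i) x w) := by
      intro x v w
      have h1 := hi.ricci_eq hI x v w
      have h2 := hI.2 x v w
      erw [hc x v w] at h1
      rw [h2]
      linarith
    by_cases hcm : c ≤ m
    · refine ⟨m - c, sub_nonneg.2 hcm, fun x t ht => ?_⟩
      -- both sides lie in the tangent plane, so that it is enough to pair them with tangent vectors
      have hmem := Submodule.sub_mem _ (meanCurvatureOperator_mem hI x t)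
        (Submodule.smul_mem _ (-((m : ℝ) - c)) ht)
      rw [← sub_eq_zero, ← inner_self_eq_zero (𝕜 := ℝ)]
      obtain ⟨w, hw⟩ := (mem_orthogonal_gaussMap hI x).1 hmem
      obtain ⟨v, rfl⟩ := (mem_orthogonal_gaussMap hI x).1 ht
      nth_rewrite 2 [← hw]
      rw [inner_sub_left, hinner, inner_smul_left]
      simp
    · -- since `A ≤ 0`, there are no non-zero tangent vectors in this case
      refine ⟨0, le_rfl, fun x t ht => ?_⟩
      obtain ⟨v, rfl⟩ := (mem_orthogonal_gaussMap hI x).1 ht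
      have h1 := inner_meanCurvatureOperator_nonpos hI x v
      rw [hinner] at h1
      have h2 : differential (sphereIncl n ∘ i) x v = 0 := by
        rw [← inner_self_eq_zero (𝕜 := ℝ)]
        exact le_antisymm (nonpos_of_mul_nonpos_right h1 (by linarith)) real_inner_self_nonneg
      rw [h2, map_zero, smul_zero]

end Sphere

end EHGauss

end

theorem mainTheorem11 {m n : ℕ} {M : Type*} [TopologicalSpace M]
    [ChartedSpace (EuclideanSpace ℝ (Fin m)) M] [IsManifold (𝓡 m) ∞ M]
    (g : EHGauss.RiemMetric m M) (i : M → EHGauss.UnitSphere n)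
    (hi : EHGauss.IsIsometricMinimalImmersion g i) :
    ∃ hI : EHGauss.IsIsometricImmersion g (EHGauss.sphereIncl n ∘ i),
      EHGauss.HasParallelMeanCurvature g (EHGauss.sphereIncl n ∘ i) ∧
      (EHGauss.IsEHHarmonic g (EHGauss.gaussMap hI) ↔ EHGauss.IsEinstein g) := by
  have hI := hi.1.comp_sphereIncl
  refine ⟨hI, hi.hasParallelMeanCurvature, ?_⟩
  rw [← hi.isEinsteinHermitian_gaussMap_iff hI]
  exact and_iff_right (hi.hasParallelMeanCurvature.isHarmonicMap_gaussMap hI)
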